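/- Let $\mathfrak g_{\mathbb C}$ be either a complex simple (finite-dimensional) Lie algebra with a Cartan subalgebra $\mathfrak t_{\mathbb C}$, root system $\Phi$, set of simple roots $\Pi$, positive roots $\Phi^+$, $\Phi^-=-\Phi^+$, and a Chevalley basis $\mathcal B=\{e_\alpha\mid\alpha\in\Phi\}\cup\{h_\beta\mid\beta\in\Pi\}$, or $\mathfrak{gl}_N(\mathbb C)$ with $\mathcal B$ the basis of matrix units $e_{ij}$, where $\mathfrak t_{\mathbb C}$ and the Borel subalgebra $\mathfrak b_{\mathbb C}$ are the diagonal and the upper triangular matrices. Put $\mathcal B^0=\mathcal B\cap\mathfrak t_{\mathbb C}$ and let $\mathcal B^{\pm}$ be the set of root vectors $e_\alpha$ in $\mathcal B$ with $\alpha\in\Phi^{\pm}$. Let $R=\mathcal S^{-1}\mathbb Z$, where $\mathcal S\subseteq\mathbb Z\setminus\{0\}$ is a finitely generated multiplicative set containing all primes that are not very good for $\Phi$ (for $\mathfrak{gl}_N$: all primes dividing $N$). Let $\mathbb K$ be an algebraically closed field of characteristic $p>0$ such that $p$ is not invertible in $R$. Let $\mathfrak g_R$, $\mathfrak t_R$,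 $\mathfrak n_R^{\pm}$ be the $R$-spans of $\mathcal B$, $\mathcal B^0$, $\mathcal B^{\pm}$; let $\mathfrak g_{\mathbb K}$, $\mathfrak t_{\mathbb K}$, $\mathfrak n^{\pm}_{\mathbb K}$ be their base changes to $\mathbb K$, and $\mathfrak b_{\mathbb K}=\mathfrak t_{\mathbb K}\oplus\mathfrak n^+_{\mathbb K}$. Let $x\mapsto x^{[p]}$ be the natural restricted structure of $\mathfrak g_{\mathbb K}$ (given by $\operatorname{ad}(x^{[p]})=\operatorname{ad}(x)^p$ if $\mathfrak g_{\mathbb C}$ is simple, by the $p$-th power of matrices for $\mathfrak{gl}_N$). For $\lambda\in\mathfrak t_R^*=\operatorname{Hom}_R(\mathfrak t_R,R)$ let $L_{\mathbb C}(\lambda)$ be the simple highest weight $U(\mathfrak g_{\mathbb C})$-module of highest weight $\lambda$ (extended to $\mathfrak t_{\mathbb C}$), with highest weight vector $\bar v_\lambda$; put $L_R(\lambda)=U(\mathfrak g_R)\bar v_\lambda$ and $L_p(\lambda)=L_R(\lambda)\otimes_R\mathbb K$, and let $\widetilde\lambda\in\mathfrak t_{\mathbb K}^*$ be the image of $\lambda$.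 For $\chi\in\mathfrak g_{\mathbb K}^*$ let $J_\chi$ be the ideal of $U(\mathfrak g_{\mathbb K})$ generated by all $x^p-x^{[p]}-\chi(x)^p$, and put $U_\chi(\mathfrak g_{\mathbb K})=U(\mathfrak g_{\mathbb K})/J_\chi$ and $L_p^\chi(\lambda)=L_p(\lambda)/J_\chi L_p(\lambda)$. Suppose that $\chi$ is in standard Levi form, i.e. $\chi(\mathfrak b_{\mathbb K})=0$ and there is $I\subseteq\Pi$ such that $\chi(e_{-\alpha})=1$ for $\alpha\in I$ and $\chi(e_{-\alpha})=0$ for $\alpha\in\Phi^+\setminus I$. Let $Z_\chi(\widetilde\lambda)=U_\chi(\mathfrak g_{\mathbb K})\otimes_{U_\chi(\mathfrak b_{\mathbb K})}\mathbb K_{\widetilde\lambda}$ be the baby Verma module, where $\mathfrak n^+_{\mathbb K}$ acts on the one-dimensional module $\mathbb K_{\widetilde\lambda}$ by $0$ and $\mathfrak t_{\mathbb K}$ acts by $\widetilde\lambda$. If $L_p^\chi(\lambda)\neq0$, then $Z_\chi(\widetilde\lambda)$ has a unique simple quotient $L_\chi(\widetilde\lambda)$, and there is a surjective homomorphism of $U_\chi(\mathfrak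 g_{\mathbb K})$-modules $L_p^\chi(\lambda)\twoheadrightarrow L_\chi(\widetilde\lambda)$. -/

import Mathlib

open scoped TensorProduct

/-! Associative algebras are Lie algebras via the commutator (needed for `gl_N`). -/

attribute [local instance 100] LieRing.ofAssociativeRing

noncomputable section

namespace ModularReduction

/-! ### Modules: the largest proper submodule, and Lie modules as modules over `U(L)` -/

section Generic

/-- The sum of all proper submodules of `M`.  For a nonzero finitely generated module `M`, the
quotient of `M` by it is simple if and only if `M` has a unique maximal submodule, and then this is
that maximal submodule. -/
def maxSubmodule (A M : Type*) [Ring A] [AddCommGroup M] [Module A M] : Submodule A M :=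
  sSup {N | N ≠ ⊤}

/-- A module over the universal enveloping algebra `U(L)`, regarded as a module for the
Lie algebra `L`. -/
@[reducible]
def lieRingModuleOfUEA (k L V : Type*) [CommRing k] [LieRing L] [LieAlgebra k L]
    [AddCommGroup V] [Module (UniversalEnvelopingAlgebra k L) V] : LieRingModule L V where
  bracket x v := UniversalEnvelopingAlgebra.ι k x • v
  add_lie x y v := by
    rw [map_add, add_smul]
  lie_add x v w := smul_add _ v w
  leibniz_lie x y v := by
    change UniversalEnvelopingAlgebra.ι k x • UniversalEnvelopingAlgebra.ι k y • v =
      UniversalEnvelopingAlgebra.ι k ⁅x, y⁆ • v +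
        UniversalEnvelopingAlgebra.ι k y • UniversalEnvelopingAlgebra.ι k x • v
    rw [LieHom.map_lie, LieRing.of_associative_ring_bracket, sub_smul, mul_smul, mul_smul,
      sub_add_cancel]

/-- A module for the Lie algebra `L`, regarded as a module over the universal enveloping
algebra `U(L)`. -/
@[reducible]
def ueaModuleOfLie (k L V : Type*) [CommRing k] [LieRing L] [LieAlgebra k L]
    [AddCommGroup V] [Module k V] [LieRingModule L V] [LieModule k L V] :
    Module (UniversalEnvelopingAlgebra k L) V :=
  Module.compHom V
    (UniversalEnvelopingAlgebra.lift k (LieModule.toEnd k L V)).toRingHom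

end Generic

/-! ### A complex Lie algebra with a triangular basis with integral structure constants -/

/-- A basis `𝓑 = 𝓑⁻ ∪ 𝓑⁰ ∪ 𝓑⁺` of a complex Lie algebra with integral structure constants.
The sign of an index tells in which of the three parts the basis vector lies; `negSimple` is the
set of indices of the root vectors `e_{-α}` with `α` a simple root. -/
structure IntegralFrame (ι g : Type*) [LieRing g] [LieAlgebra ℂ g] where
  basis : Module.Basis ι ℂ g
  sgn : ι → SignType
  negSimple : Set ι
  lie_mem : ∀ i j, ⁅basis i, basis j⁆ ∈ Submodule.span ℤ (Set.range basis)

namespace IntegralFrame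

variable {ι g : Type*} [LieRing g] [LieAlgebra ℂ g] (F : IntegralFrame ι g)

/-- The `ℂ`-span of the basis vectors of sign `s`: this is `𝔫⁻`, `𝔱` or `𝔫⁺` over `ℂ`. -/
def partC (s : SignType) : Submodule ℂ g :=
  Submodule.span ℂ (Set.range fun i : {i // F.sgn i = s} => F.basis i)

/-- The left ideal of `U(𝔤_ℂ)` generated by `𝔫⁺` and all `h - μ(h)`, `h ∈ 𝔱_ℂ`. -/
def vermaIdeal (μ : Module.Dual ℂ (F.partC 0)) :
    Submodule (UniversalEnvelopingAlgebra ℂ g) (UniversalEnvelopingAlgebra ℂ g) :=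
  Ideal.span
    ({u | ∃ x ∈ F.partC 1, u = UniversalEnvelopingAlgebra.ι ℂ x} ∪
      {u | ∃ h : F.partC 0, u = UniversalEnvelopingAlgebra.ι ℂ (h : g) -
        algebraMap ℂ (UniversalEnvelopingAlgebra ℂ g) (μ h)})

/-- The Verma module `M_ℂ(μ) = U(𝔤_ℂ) ⊗_{U(𝔟_ℂ)} ℂ_μ`, presented as the quotient of `U(𝔤_ℂ)` by
the left ideal generated by `𝔫⁺` and all `h - μ(h)`. -/
abbrev Verma (μ : Module.Dual ℂ (F.partC 0)) : Type _ :=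
  UniversalEnvelopingAlgebra ℂ g ⧸ F.vermaIdeal μ

/-- The simple quotient `L_ℂ(μ)` of the Verma module. -/
abbrev SimpleC (μ : Module.Dual ℂ (F.partC 0)) : Type _ :=
  F.Verma μ ⧸ maxSubmodule (UniversalEnvelopingAlgebra ℂ g) (F.Verma μ)

/-- The highest weight vector `v̄` of `L_ℂ(μ)`, the image of `1 ∈ U(𝔤_ℂ)`. -/
def highestWeightVector (μ : Module.Dual ℂ (F.partC 0)) : F.SimpleC μ :=
  Submodule.Quotient.mk (Submodule.Quotient.mk 1)

section OverR

variable (R : Type*) [CommRing R] [Algebra R ℂ]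

/-- `L_ℂ(μ)` with scalars restricted to `R`. -/
def SimpleCRes (μ : Module.Dual ℂ (F.partC 0)) : Type _ := RestrictScalars R ℂ (F.SimpleC μ)

instance (μ : Module.Dual ℂ (F.partC 0)) : AddCommGroup (F.SimpleCRes R μ) :=
  inferInstanceAs (AddCommGroup (F.SimpleC μ))

instance (μ : Module.Dual ℂ (F.partC 0)) :
    Module (UniversalEnvelopingAlgebra ℂ g) (F.SimpleCRes R μ) :=
  inferInstanceAs (Module (UniversalEnvelopingAlgebra ℂ g) (F.SimpleC μ))

instance (μ : Module.Dual ℂ (F.partC 0)) : Module ℂ (F.SimpleCRes R μ) :=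
  inferInstanceAs (Module ℂ (F.SimpleC μ))

instance (μ : Module.Dual ℂ (F.partC 0)) : Module R (F.SimpleCRes R μ) :=
  inferInstanceAs (Module R (RestrictScalars R ℂ (F.SimpleC μ)))

instance (μ : Module.Dual ℂ (F.partC 0)) :
    IsScalarTower ℂ (UniversalEnvelopingAlgebra ℂ g) (F.SimpleCRes R μ) :=
  inferInstanceAs (IsScalarTower ℂ (UniversalEnvelopingAlgebra ℂ g) (F.SimpleC μ))

instance (μ : Module.Dual ℂ (F.partC 0)) : LieRingModule g (F.SimpleCRes R μ) :=
  lieRingModuleOfUEA ℂ g _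

theorem smul_eq_algebraMap_smul (μ : Module.Dual ℂ (F.partC 0)) (r : R) (v : F.SimpleCRes R μ) :
    r • v = algebraMap ℂ (UniversalEnvelopingAlgebra ℂ g) (algebraMap R ℂ r) • v := by
  rw [algebraMap_smul]
  rfl

variable [LieAlgebra R g] [IsScalarTower R ℂ g]

instance (μ : Module.Dual ℂ (F.partC 0)) : LieModule R g (F.SimpleCRes R μ) where
  smul_lie r x v := by
    change UniversalEnvelopingAlgebra.ι ℂ (r • x) • v = r • UniversalEnvelopingAlgebra.ι ℂ x • v
    rw [smul_eq_algebraMap_smul, ← algebraMap_smul ℂ r x, ← LieHom.coe_toLinearMap,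
      LinearMap.map_smul, smul_assoc,
      algebraMap_smul (UniversalEnvelopingAlgebra ℂ g) (algebraMap R ℂ r)]
  lie_smul r x v := by
    change UniversalEnvelopingAlgebra.ι ℂ x • r • v = r • UniversalEnvelopingAlgebra.ι ℂ x • v
    rw [smul_eq_algebraMap_smul, smul_eq_algebraMap_smul, ← mul_smul, ← mul_smul,
      Algebra.commutes]

/-- The `R`-form `𝔤_R`, the `R`-span of the basis `𝓑`. -/
def gR : LieSubalgebra R g where
  toSubmodule := Submodule.span R (Set.range F.basis)
  lie_mem' := by
    intro x y hx hy
    have hZ : ∀ z ∈ Submodule.span ℤ (Set.range F.basis),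
        z ∈ Submodule.span R (Set.range F.basis) := fun z hz =>
      Submodule.span_le_restrictScalars ℤ R _ hz
    change x ∈ Submodule.span R (Set.range F.basis) at hx
    change y ∈ Submodule.span R (Set.range F.basis) at hy
    change ⁅x, y⁆ ∈ Submodule.span R (Set.range F.basis)
    induction hx using Submodule.span_induction with
    | mem x hx =>
      obtain ⟨i, rfl⟩ := hx
      induction hy using Submodule.span_induction with
      | mem y hy =>
        obtain ⟨j, rfl⟩ := hy
        exact hZ _ (F.lie_mem i j)
      | zero => rw [lie_zero]; exact Submodule.zero_mem _
      | add u v _ _ hu hv => rw [lie_add]; exact Submodule.add_mem _ hu hv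
      | smul r u _ hu => rw [lie_smul]; exact Submodule.smul_mem _ r hu
    | zero => rw [zero_lie]; exact Submodule.zero_mem _
    | add u v _ _ hu hv => rw [add_lie]; exact Submodule.add_mem _ hu hv
    | smul r u _ hu => rw [smul_lie]; exact Submodule.smul_mem _ r hu

/-- The elements of the basis `𝓑`, as elements of `𝔤_R`. -/
def basisElt (i : ι) : F.gR R :=
  ⟨F.basis i, Submodule.subset_span ⟨i, rfl⟩⟩

/-- The `R`-span of the basis vectors of sign `s`: this is `𝔫⁻_R`, `𝔱_R` or `𝔫⁺_R`. -/
def partR (s : SignType) : Submodule R (F.gR R) :=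
  Submodule.span R (Set.range fun i : {i // F.sgn i = s} => F.basisElt R i)

/-- The embedding `𝔱_R^* ↪ 𝔱_ℂ^*`: `λ` goes to the `ℂ`-linear form with the same values on the
basis `𝓑⁰`. -/
def extendC (lam : Module.Dual R (F.partR R 0)) : Module.Dual ℂ (F.partC 0) :=
  (Module.Basis.span
    (F.basis.linearIndependent.comp (Subtype.val : {i // F.sgn i = 0} → ι)
      Subtype.val_injective)).constr ℂ
    fun i => algebraMap R ℂ (lam ⟨F.basisElt R i, Submodule.subset_span ⟨i, rfl⟩⟩)

/-- The vector `v̄` as an element of `L_ℂ(μ)` with scalars restricted to `R`. -/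
def highestWeightVectorRes (μ : Module.Dual ℂ (F.partC 0)) : F.SimpleCRes R μ :=
  F.highestWeightVector μ

/-- `L_R(λ) = U(𝔤_R) v̄` inside `L_ℂ(λ)`, as a module for the Lie algebra `𝔤_R`. -/
def LR (lam : Module.Dual R (F.partR R 0)) :
    LieSubmodule R (F.gR R) (F.SimpleCRes R (F.extendC R lam)) where
  carrier := {m | ∃ u : UniversalEnvelopingAlgebra R (F.gR R),
    m = UniversalEnvelopingAlgebra.lift R
      (LieModule.toEnd R (F.gR R) (F.SimpleCRes R (F.extendC R lam))) u
      (F.highestWeightVectorRes R (F.extendC R lam))}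
  add_mem' := by
    rintro _ _ ⟨u, rfl⟩ ⟨v, rfl⟩
    exact ⟨u + v, by rw [map_add, LinearMap.add_apply]⟩
  zero_mem' := ⟨0, by rw [map_zero, LinearMap.zero_apply]⟩
  smul_mem' := by
    rintro r _ ⟨u, rfl⟩
    exact ⟨r • u, by rw [map_smul, LinearMap.smul_apply]⟩
  lie_mem := by
    rintro x _ ⟨u, rfl⟩
    refine ⟨UniversalEnvelopingAlgebra.ι R x * u, ?_⟩
    rw [map_mul, UniversalEnvelopingAlgebra.lift_ι_apply]
    rfl

section OverK

variable (K : Type*) [Field K] [Algebra R K]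

/-- `𝔤_K = 𝔤_R ⊗_R K`. -/
abbrev gK : Type _ := K ⊗[R] F.gR R

/-- The image `λ̃ ∈ 𝔱_K^*` of `λ ∈ 𝔱_R^*`, where `𝔱_K = 𝔱_R ⊗_R K`. -/
def tilde (lam : Module.Dual R (F.partR R 0)) : Module.Dual K (K ⊗[R] F.partR R 0) :=
  Module.Dual.baseChange K lam

/-- The `U(𝔤_K)`-module `L_p(λ) = L_R(λ) ⊗_R K`. -/
def Lp (lam : Module.Dual R (F.partR R 0)) : Type _ := K ⊗[R] F.LR R lam

instance (lam : Module.Dual R (F.partR R 0)) : AddCommGroup (F.Lp R K lam) :=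
  inferInstanceAs (AddCommGroup (K ⊗[R] F.LR R lam))

instance (lam : Module.Dual R (F.partR R 0)) :
    Module (UniversalEnvelopingAlgebra K (F.gK R K)) (F.Lp R K lam) :=
  ueaModuleOfLie K (F.gK R K) (K ⊗[R] F.LR R lam)

variable (p : ℕ) (pMap : F.gK R K → F.gK R K) (chi : Module.Dual K (F.gK R K))

/-- The two-sided ideal of `U(𝔤_K)` generated by the elements `x^p - x^{[p]} - χ(x)^p`, where
`x ↦ x^{[p]}` is the given map `pMap`. -/
def J : Ideal (UniversalEnvelopingAlgebra K (F.gK R K)) :=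
  (TwoSidedIdeal.span (Set.range fun x : F.gK R K =>
    UniversalEnvelopingAlgebra.ι K x ^ p - UniversalEnvelopingAlgebra.ι K (pMap x) -
      algebraMap K (UniversalEnvelopingAlgebra K (F.gK R K)) (chi x ^ p))).asIdeal

instance : (F.J R K p pMap chi).IsTwoSided :=
  inferInstanceAs (TwoSidedIdeal.asIdeal _).IsTwoSided

/-- The reduced enveloping algebra `U_χ(𝔤_K)`. -/
abbrev Uchi : Type _ := UniversalEnvelopingAlgebra K (F.gK R K) ⧸ F.J R K p pMap chi

/-- The `U_χ(𝔤_K)`-module `L_p^χ(λ) = L_p(λ) / J_χ L_p(λ)`. -/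
abbrev Lpchi (lam : Module.Dual R (F.partR R 0)) : Type _ :=
  F.Lp R K lam ⧸
    (F.J R K p pMap chi • (⊤ : Submodule (UniversalEnvelopingAlgebra K (F.gK R K)) (F.Lp R K lam)))

/-- The left ideal of `U_χ(𝔤_K)` generated by `𝔫⁺_K` and all `h - μ(h)`, `h ∈ 𝔱_K`. -/
def babyVermaIdeal (mu : Module.Dual K (K ⊗[R] F.partR R 0)) :
    Submodule (F.Uchi R K p pMap chi) (F.Uchi R K p pMap chi) :=
  Ideal.span
    ({u | ∃ x : K ⊗[R] F.partR R 1,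
        u = Ideal.Quotient.mk (F.J R K p pMap chi)
          (UniversalEnvelopingAlgebra.ι K ((F.partR R 1).subtype.baseChange K x))} ∪
      {u | ∃ h : K ⊗[R] F.partR R 0,
        u = Ideal.Quotient.mk (F.J R K p pMap chi)
          (UniversalEnvelopingAlgebra.ι K ((F.partR R 0).subtype.baseChange K h) -
            algebraMap K (UniversalEnvelopingAlgebra K (F.gK R K)) (mu h))})

/-- The baby Verma module `Z_χ(μ) = U_χ(𝔤_K) ⊗_{U_χ(𝔟_K)} K_μ`, presented as the quotient of
`U_χ(𝔤_K)` by the left ideal generated by `𝔫⁺_K` and all `h - μ(h)`. -/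
abbrev BabyVerma (mu : Module.Dual K (K ⊗[R] F.partR R 0)) : Type _ :=
  F.Uchi R K p pMap chi ⧸ F.babyVermaIdeal R K p pMap chi mu

/-- `L_χ(μ)`, the quotient of the baby Verma module `Z_χ(μ)` by its largest proper submodule. -/
abbrev Lchi (mu : Module.Dual K (K ⊗[R] F.partR R 0)) : Type _ :=
  F.BabyVerma R K p pMap chi mu ⧸
    maxSubmodule (F.Uchi R K p pMap chi) (F.BabyVerma R K p pMap chi mu)

/-- `χ` is in standard Levi form: it vanishes on `𝔟_K`, and there is a set `I` of simple roots such
that `χ(e_{-α}) = 1` for `α ∈ I` and `χ(e_{-α}) = 0` for all other positive roots `α`. -/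
def IsStandardLevi : Prop :=
  (∀ i, F.sgn i = 0 ∨ F.sgn i = 1 → chi (1 ⊗ₜ F.basisElt R i) = 0) ∧
    ∃ I ⊆ F.negSimple, ∀ i, F.sgn i = -1 →
      (i ∈ I → chi (1 ⊗ₜ F.basisElt R i) = 1) ∧ (i ∉ I → chi (1 ⊗ₜ F.basisElt R i) = 0)

end OverK

end OverR

end IntegralFrame

/-! ### Simple Lie algebras -/

section Simple

open LieAlgebra LieAlgebra.IsKilling

variable {g : Type*} [LieRing g] [LieAlgebra ℂ g] [FiniteDimensional ℂ g] [LieAlgebra.IsKilling ℂ g]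
  {H : LieSubalgebra ℂ g} [H.IsCartanSubalgebra]

/-- A Chevalley basis `{e_α | α ∈ Φ} ∪ {h_β | β ∈ Π}`: each `e_α` is a root vector, `[e_α, e_{-α}]` is
the coroot of `α`, the `h_β` are the simple coroots (so `h_β = [e_β, e_{-β}]`), and
`[e_α, e_β] = ±(r + 1) e_{α + β}` if `α`, `β`, `α + β` are roots, where `r` is the largest integer
such that `β - r α` is a root. -/
structure IsChevalleyBasis (b : (rootSystem H).Base)
    (B : Module.Basis (H.root ⊕ b.support) ℂ g) : Prop where
  root_mem : ∀ α : H.root, B (.inl α) ∈ LieAlgebra.rootSpace H (α : LieModule.Weight ℂ H g)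
  lie_neg : ∀ α β : H.root, (rootSystem H).root β = -(rootSystem H).root α →
    ⁅B (.inl α), B (.inl β)⁆ = ((rootSystem H).coroot α : g)
  simple_coroot : ∀ i : b.support, B (.inr i) = ((rootSystem H).coroot i : g)
  lie_add : ∀ α β γ : H.root,
    (rootSystem H).root γ = (rootSystem H).root α + (rootSystem H).root β →
    ⁅B (.inl α), B (.inl β)⁆ = (((rootSystem H).chainBotCoeff α β + 1 : ℕ) : ℂ) • B (.inl γ) ∨
    ⁅B (.inl α), B (.inl β)⁆ = -((((rootSystem H).chainBotCoeff α β + 1 : ℕ) : ℂ) • B (.inl γ))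


theorem IsChevalleyBasis.lie_mem {b : (rootSystem H).Base}
    {B : Module.Basis (H.root ⊕ b.support) ℂ g} (hB : IsChevalleyBasis b B)
    (i j : H.root ⊕ b.support) : ⁅B i, B j⁆ ∈ Submodule.span ℤ (Set.range B) := by
  have hbas : ∀ i, B i ∈ Submodule.span ℤ (Set.range B) := fun i => Submodule.subset_span ⟨i, rfl⟩
  have hcast : ∀ (n : ℤ) i, (n : ℂ) • B i ∈ Submodule.span ℤ (Set.range B) := fun n i => by
    rw [Int.cast_smul_eq_zsmul]
    exact Submodule.smul_mem _ _ (hbas i)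
  have hcast' : ∀ (n : ℕ) i, (n : ℂ) • B i ∈ Submodule.span ℤ (Set.range B) := fun n i => by
    have := hcast n i
    rwa [Int.cast_natCast] at this
  have hhe : ∀ (k : b.support) (α : H.root),
      ⁅B (.inr k), B (.inl α)⁆ ∈ Submodule.span ℤ (Set.range B) := by
    intro k α
    have h1 := lie_eq_smul_of_mem_rootSpace (hB.root_mem α) ((rootSystem H).coroot k)
    have h2 : ⁅B (.inr k), B (.inl α)⁆ =
        ((α : LieModule.Weight ℂ H g) ((rootSystem H).coroot k)) • B (.inl α) := by
      rw [hB.simple_coroot]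
      exact h1
    obtain ⟨n, hn⟩ := (rootSystem H).exists_value (S := ℤ) α k
    rw [h2]
    have h3 : (α : LieModule.Weight ℂ H g) ((rootSystem H).coroot k) = (n : ℂ) := by
      exact hn.symm
    rw [h3]
    exact hcast n _
  have hcoroot : ∀ α : H.root,
      ((rootSystem H).coroot α : g) ∈ Submodule.span ℤ (Set.range B) := by
    intro α
    have h1 := Submodule.mem_map_of_mem (f := (H.toSubmodule.subtype.restrictScalars ℤ))
      (b.coroot_mem_span_int α)
    rw [Submodule.map_span] at h1
    refine Submodule.span_mono ?_ h1
    rintro _ ⟨_, ⟨k, hk, rfl⟩, rfl⟩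
    exact ⟨.inr ⟨k, hk⟩, hB.simple_coroot ⟨k, hk⟩⟩
  rcases i with α | k <;> rcases j with β | l
  · by_cases h0 : (rootSystem H).root β = -(rootSystem H).root α
    · rw [hB.lie_neg α β h0]
      exact hcoroot α
    · have hmem := LieAlgebra.lie_mem_genWeightSpace_of_mem_genWeightSpace
        (hB.root_mem α) (hB.root_mem β)
      by_cases hbot : LieAlgebra.rootSpace H
          ((α : LieModule.Weight ℂ H g) + (β : LieModule.Weight ℂ H g) : H → ℂ) = ⊥
      · have h3 : ⁅B (.inl α), B (.inl β)⁆ ∈ (⊥ : LieSubmodule ℂ H g) := hbot.le hmem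
        rw [(LieSubmodule.mem_bot _).1 h3]
        exact Submodule.zero_mem _
      · let w : LieModule.Weight ℂ H g := ⟨_, hbot⟩
        have hw : w ∈ H.root := by
          simp only [Finset.mem_filter, Finset.mem_univ, true_and]
          intro hz
          apply h0
          ext x
          have h4 := congrFun hz x
          exact eq_neg_of_add_eq_zero_right h4
        rcases hB.lie_add α β ⟨w, hw⟩ (by ext; rfl) with h | h
        · rw [h]; exact hcast' _ _
        · rw [h]; exact Submodule.neg_mem _ (hcast' _ _)
  · rw [← lie_skew]
    exact Submodule.neg_mem _ (hhe l α)
  · exact hhe k β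
  · rw [hB.simple_coroot, hB.simple_coroot, ← LieSubalgebra.coe_bracket, trivial_lie_zero,
      ZeroMemClass.coe_zero]
    exact Submodule.zero_mem _

open Classical in
/-- The frame given by a Chevalley basis and a base of the root system. -/
def chevalleyFrame {b : (rootSystem H).Base} {B : Module.Basis (H.root ⊕ b.support) ℂ g}
    (hB : IsChevalleyBasis b B) : IntegralFrame (H.root ⊕ b.support) g where
  basis := B
  sgn := Sum.elim (fun α => if b.IsPos α then 1 else -1) fun _ => 0
  negSimple := {i | ∃ α : H.root, ∃ β ∈ b.support,
    (rootSystem H).root α = -(rootSystem H).root β ∧ i = .inl α}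
  lie_mem := hB.lie_mem

open Classical in
/-- The prime `q` is very good for the (irreducible) root system: it is good, i.e. it divides no
nonzero coefficient of a root in terms of the simple roots, and it does not divide the index of
connection, i.e. the determinant of the Cartan matrix (for good `q` the latter only
excludes the divisors of `n + 1` in type `A_n`). -/
def IsVeryGood (b : (rootSystem H).Base) (q : ℕ) : Prop :=
  (∀ (α : H.root) (f : b.support → ℤ),
      (rootSystem H).root α = ∑ i, f i • (rootSystem H).root i →
      ∀ i, f i ≠ 0 → ¬ (q : ℤ) ∣ f i) ∧
    ¬ (q : ℤ) ∣ b.cartanMatrix.det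

end Simple

/-! ### The Lie algebra `gl_N` -/

section GeneralLinear

/-- The frame of `gl_N(ℂ)` given by the matrix units `e_{ij}`; the Borel subalgebra consists
of the upper triangular matrices. -/
def glFrame (N : ℕ) : IntegralFrame (Fin N × Fin N) (Matrix (Fin N) (Fin N) ℂ) where
  basis := Matrix.stdBasis ℂ (Fin N) (Fin N)
  sgn ij := SignType.sign ((ij.2 : ℤ) - (ij.1 : ℤ))
  negSimple := {ij | (ij.1 : ℕ) = (ij.2 : ℕ) + 1}
  lie_mem := by
    rintro ⟨i, j⟩ ⟨k, l⟩
    have h : ∀ a b c d : Fin N, Matrix.single a b (1 : ℂ) * Matrix.single c d 1 ∈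
        Submodule.span ℤ (Set.range (Matrix.stdBasis ℂ (Fin N) (Fin N))) := by
      intro a b c d
      by_cases hbc : b = c
      · subst hbc
        rw [Matrix.single_mul_single_same, mul_one]
        exact Submodule.subset_span ⟨(a, d), Matrix.stdBasis_eq_single _ _ _⟩
      · rw [Matrix.single_mul_single_of_ne _ _ _ _ hbc]
        exact Submodule.zero_mem _
    rw [Matrix.stdBasis_eq_single, Matrix.stdBasis_eq_single, LieRing.of_associative_ring_bracket]
    exact Submodule.sub_mem _ (h _ _ _ _) (h _ _ _ _)

end GeneralLinear

/-! ### The restricted structures -/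

section PMap

/-- The map `x ↦ x^{[p]}` characterised by `ρ(x^{[p]}) = ρ(x)^p`, where `ρ` is injective and its
image is closed under `p`-th powers. -/
def pMapOf {L A : Type*} [Nonempty L] [Monoid A] (ρ : L → A) (p : ℕ) (x : L) : L :=
  Function.invFun ρ (ρ x ^ p)

variable {ι g : Type*} [LieRing g] [LieAlgebra ℂ g] (F : IntegralFrame ι g)
  (R : Type*) [CommRing R] [Algebra R ℂ] [LieAlgebra R g] [IsScalarTower R ℂ g]
  (K : Type*) [Field K] [Algebra R K]

/-- The restricted structure on a Lie algebra `𝔤_K` with trivial centre, given by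
`ad(x^{[p]}) = ad(x)^p`. -/
def adPMap (p : ℕ) : F.gK R K → F.gK R K :=
  pMapOf (LieAlgebra.ad K (F.gK R K)) p

/-- The basis `𝓑` as an `R`-basis of `𝔤_R`. -/
def IntegralFrame.basisR [FaithfulSMul R ℂ] : Module.Basis ι R (F.gR R) :=
  Module.Basis.span (F.basis.linearIndependent.restrict_scalars' R)

/-- The identification of `gl_N(R) ⊗_R K` with the `N × N` matrices over `K`, under which `e_{ij} ⊗ 1`
goes to `e_{ij}`. -/
def glToMatrix (N : ℕ) [FaithfulSMul R ℂ] :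
    (glFrame N).gK R K →ₗ[K] Matrix (Fin N) (Fin N) K :=
  (((glFrame N).basisR R).baseChange K).constr K fun ij => Matrix.single ij.1 ij.2 1

/-- The restricted structure on `gl_N(K)`: the `p`-th power of matrices. -/
def glPMap (N : ℕ) [FaithfulSMul R ℂ] (p : ℕ) : (glFrame N).gK R K → (glFrame N).gK R K :=
  pMapOf (glToMatrix R K N) p

end PMap

end ModularReduction

end

noncomputable section

set_option linter.unusedSectionVars false

/-! The image of the highest weight vector generates L_p^χ(λ), is killed by 𝔫⁺ and has weight λ̃, so
L_p^χ(λ) is a quotient of the baby Verma module Z = Z_χ(λ̃) (`babyVermaToLpchi`). If it is nonzero,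
the kernel is a proper submodule, hence is contained in the sum of all proper submodules, and Z
modulo that sum is a quotient of L_p^χ(λ). It remains to see that this sum is a maximal submodule
(`isSimpleModule_quotient_maxSubmodule`).

For a negative root vector e put T_e = e - χ(e). If e^{[p]} = 0, then T_e^p = e^p - χ(e)^p = 0 in
U_χ. The bracket of two negative root vectors involves no e_{-α} with α simple, so standard Levi
form makes χ vanish on it. Thus commutators of the operators T are combinations of operators T of
greater depth, and an Engel type argument (`eq_top_of_sup_iSup_range_eq_top`) applies: with M the
sum of the images of the T_e, a T-stable subspace W with W + M = Z is all of Z. Taking W = 0 gives M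
≠ Z, while Z = Kv + M for the generator v. A submodule N not inside M satisfies N + M = Z, hence N =
Z. So all proper submodules lie in M, and so does their sum.

The equation e^{[p]} = 0 is clear for off-diagonal matrix units. For a Chevalley basis, (ad e_α)^p
is divisible by p on the ℤ-form, because powers of ad e_α produce products of consecutive integers.
Moreover ad is injective on 𝔤_K: since p is not invertible in R it is very good, so no root vanishes
modulo p on the simple coroots and the Cartan matrix stays invertible. -/

namespace ModularReduction

/-! ### Engel's theorem and unique maximal submodules. -/

section Generic

theorem adjoin_range_ι (k L : Type*) [CommRing k] [LieRing L] [LieAlgebra k L] :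
    Algebra.adjoin k (Set.range (UniversalEnvelopingAlgebra.ι k (L := L))) = ⊤ := by
  set S := Algebra.adjoin k (Set.range (UniversalEnvelopingAlgebra.ι k (L := L))) with hS
  let f : L →ₗ⁅k⁆ S :=
    { toFun := fun x => ⟨UniversalEnvelopingAlgebra.ι k x, Algebra.subset_adjoin ⟨x, rfl⟩⟩
      map_add' := fun x y => Subtype.ext (map_add (UniversalEnvelopingAlgebra.ι k) x y)
      map_smul' := fun r x => Subtype.ext (map_smul (UniversalEnvelopingAlgebra.ι k) r x)
      map_lie' := fun {x y} => Subtype.ext (LieHom.map_lie (UniversalEnvelopingAlgebra.ι k) x y) }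
  -- By uniqueness in the universal property, going into the subalgebra and back is the identity, so
  -- the inclusion is onto.
  have h : S.val.comp (UniversalEnvelopingAlgebra.lift k f) = AlgHom.id k _ := by
    apply UniversalEnvelopingAlgebra.hom_ext
    ext x
    change ((UniversalEnvelopingAlgebra.lift k f) (UniversalEnvelopingAlgebra.ι k x) : _) =
      UniversalEnvelopingAlgebra.ι k x
    rw [UniversalEnvelopingAlgebra.lift_ι_apply]
    rfl
  rw [eq_top_iff]
  intro u _
  have hu : ((UniversalEnvelopingAlgebra.lift k f u : S) : UniversalEnvelopingAlgebra k L) = u :=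
    DFunLike.congr_fun h u
  rw [← hu]
  exact Subtype.property _

/-- A form of Engel's theorem for nilpotent operators `T i` whose commutators are combinations of
operators of larger degree. -/
theorem eq_top_of_sup_iSup_range_eq_top {k Z ι : Type*} [CommRing k] [AddCommGroup Z] [Module k Z]
    (T : ι → Module.End k Z) (d : ι → ℕ) (hnil : ∀ i, IsNilpotent (T i))
    (hcomm : ∀ i j z, T i (T j z) - T j (T i z) ∈
      ⨆ l : {l // d i < d l ∧ d j < d l}, LinearMap.range (T l))
    (W : Submodule k Z) (hW : ∀ i, ∀ w ∈ W, T i w ∈ W) (s : Finset ι) :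
    (∀ j ∈ s, ∀ l, d j < d l → l ∈ s) → W ⊔ ⨆ i ∈ s, LinearMap.range (T i) = ⊤ → W = ⊤ := by
  classical
  induction s using Finset.induction_on_min_value d with
  | empty => simp
  | insert a s ha hmin ih =>
    intro hup htop
    have hup' : ∀ j ∈ s, ∀ l, d j < d l → l ∈ s := by
      intro j hj l hl
      rcases Finset.mem_insert.1 (hup j (Finset.mem_insert_of_mem hj) l hl) with rfl | h
      · exact absurd hl (not_lt.2 (hmin j hj))
      · exact h
    refine ih hup' ?_
    -- The operator `T a` of least degree is split off. It preserves `V`, since its commutators with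
    -- the other `T j` land in ranges of higher degree. Then Z = V + T_a Z iterates to Z = V + T_a^n
    -- Z, which is `V` once T_a^n = 0.
    set V := W ⊔ ⨆ i ∈ s, LinearMap.range (T i) with hV
    have hsub : ∀ j ∈ s, LinearMap.range (T j) ≤ V := fun j hj =>
      le_sup_of_le_right (le_iSup₂_of_le j hj le_rfl)
    have hstab : ∀ w ∈ V, T a w ∈ V := by
      intro w hw
      have : V ≤ V.comap (T a) := by
        refine sup_le (fun w hw => ?_) (iSup₂_le fun j hj => ?_)
        · exact Submodule.mem_sup_left (hW a w hw)
        · rintro _ ⟨z, rfl⟩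
          change T a (T j z) ∈ V
          have h1 := hcomm a j z
          rw [← sub_add_cancel (T a (T j z)) (T j (T a z))]
          refine add_mem ?_ (hsub j hj ⟨_, rfl⟩)
          refine (iSup_le fun l => ?_ : (⨆ l : {l // d a < d l ∧ d j < d l},
            LinearMap.range (T l)) ≤ V) h1
          exact hsub _ (hup' j hj _ l.2.2)
      exact this hw
    have hdec : ∀ z : Z, ∃ y, z - T a y ∈ V := by
      intro z
      have hz : z ∈ W ⊔ ⨆ i ∈ insert a s, LinearMap.range (T i) := htop ▸ Submodule.mem_top
      rw [Finset.iSup_insert, sup_left_comm] at hz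
      obtain ⟨_, ⟨y, rfl⟩, w, hw, rfl⟩ := Submodule.mem_sup.1 hz
      exact ⟨y, by simpa [hV] using hw⟩
    have hpow : ∀ (n : ℕ) (z : Z), ∃ y, z - (T a ^ n) y ∈ V := by
      intro n
      induction n with
      | zero => exact fun z => ⟨z, by simp⟩
      | succ n ihn =>
        intro z
        obtain ⟨y, hy⟩ := hdec z
        obtain ⟨x, hx⟩ := ihn y
        refine ⟨x, ?_⟩
        have := add_mem hy (hstab _ hx)
        rw [map_sub, sub_add_sub_cancel] at this
        rwa [pow_succ']
    obtain ⟨n, hn⟩ := hnil a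
    rw [eq_top_iff]
    intro z _
    obtain ⟨y, hy⟩ := hpow n z
    simpa [hn] using hy

/-- The sum of the proper submodules stays inside `M`, so it is itself proper, and anything strictly
larger is everything. Only an additive subgroup is asked for because the `M` of the application need
not be stable under `A`. -/
theorem isSimpleModule_quotient_maxSubmodule_of_le {A Z : Type*} [Ring A] [AddCommGroup Z]
    [Module A Z] (M : AddSubgroup Z) (hM : M ≠ ⊤)
    (h : ∀ N : Submodule A Z, N ≠ ⊤ → N.toAddSubgroup ≤ M) :
    IsSimpleModule A (Z ⧸ maxSubmodule A Z) := by
  rw [isSimpleModule_iff_isCoatom]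
  have hle : ∀ x ∈ maxSubmodule A Z, x ∈ M := by
    intro x hx
    rw [maxSubmodule, sSup_eq_iSup'] at hx
    induction hx using Submodule.iSup_induction' with
    | mem i x hx => exact h i.1 i.2 hx
    | zero => exact zero_mem _
    | add x y _ _ hx hy => exact add_mem hx hy
  refine ⟨fun htop => hM ?_, fun N hN => ?_⟩
  · rw [eq_top_iff]
    intro x _
    exact hle x (htop ▸ Submodule.mem_top)
  · by_contra hne
    exact not_le_of_gt hN (le_sSup hne)

/-- A cyclic module generated by a vector whose `K`-span is stable modulo the operators `f i`,
which are nilpotent after a shift by the scalars `c i`, has a unique maximal submodule. -/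
theorem isSimpleModule_quotient_maxSubmodule {K L A Z ι : Type*} [Field K] [LieRing L]
    [LieAlgebra K L] [Ring A] [Algebra K A] [AddCommGroup Z] [Module A Z] [Module K Z]
    [IsScalarTower K A Z] [Finite ι] [Nontrivial Z]
    (φ : UniversalEnvelopingAlgebra K L →ₐ[K] A) (hφ : Function.Surjective φ)
    (v : Z) (hv : Submodule.span A {v} = ⊤) (f : ι → L) (c : ι → K) (d : ι → ℕ)
    (hspan : ∀ x, φ (UniversalEnvelopingAlgebra.ι K x) • v ∈
      Submodule.span K ({v} ∪ Set.range fun i => φ (UniversalEnvelopingAlgebra.ι K (f i)) • v))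
    (hnil : ∀ i, IsNilpotent (φ (UniversalEnvelopingAlgebra.ι K (f i)) - algebraMap K A (c i)))
    (hcomm : ∀ i j, ⁅f i, f j⁆ ∈
      Submodule.span K (f '' {l | c l = 0 ∧ d i < d l ∧ d j < d l})) :
    IsSimpleModule A (Z ⧸ maxSubmodule A Z) := by
  have : Fintype ι := Fintype.ofFinite ι
  let D : L → A := fun x => φ (UniversalEnvelopingAlgebra.ι K x)
  have hD : ∀ x y, D x * D y = D y * D x + D ⁅x, y⁆ := by
    intro x y
    change φ _ * φ _ = φ _ * φ _ + φ _
    rw [LieHom.map_lie, LieRing.of_associative_ring_bracket, map_sub, map_mul, map_mul]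
    abel
  let E : L →ₗ[K] A := φ.toLinearMap ∘ₗ (UniversalEnvelopingAlgebra.ι K (L := L)).toLinearMap
  let T : ι → Module.End K Z := fun i => Algebra.lsmul K K Z (D (f i) - algebraMap K A (c i))
  have hT : ∀ i z, T i z = D (f i) • z - c i • z := by
    intro i z
    change (D (f i) - algebraMap K A (c i)) • z = _
    rw [sub_smul, algebraMap_smul]
  have hTnil : ∀ i, IsNilpotent (T i) := fun i => (hnil i).map (Algebra.lsmul K K Z)
  have hTcomm : ∀ i j z, T i (T j z) - T j (T i z) ∈
      ⨆ l : {l // d i < d l ∧ d j < d l}, LinearMap.range (T l) := by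
    intro i j z
    -- The scalar shifts cancel in the commutator. Only indices with `c l = 0` occur in the bracket,
    -- and for these `f l` acts as `T l` itself.
    have h1 : T i (T j z) - T j (T i z) = E ⁅f i, f j⁆ • z := by
      have h2 : E ⁅f i, f j⁆ = D (f i) * D (f j) - D (f j) * D (f i) := by
        rw [hD (f i), add_sub_cancel_left]
        rfl
      rw [h2]
      change (D (f i) - algebraMap K A (c i)) • (D (f j) - algebraMap K A (c j)) • z -
        (D (f j) - algebraMap K A (c j)) • (D (f i) - algebraMap K A (c i)) • z = _
      rw [← mul_smul, ← mul_smul, ← sub_smul]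
      congr 1
      rw [sub_mul, mul_sub, mul_sub, sub_mul, mul_sub, mul_sub, Algebra.commutes (c i) (D (f j)),
        Algebra.commutes (c j) (D (f i)), Algebra.commutes (c i) (algebraMap K A (c j))]
      abel
    rw [h1]
    have h3 := hcomm i j
    generalize ⁅f i, f j⁆ = x at h3
    induction h3 using Submodule.span_induction with
    | mem x hx =>
      obtain ⟨l, ⟨hl0, hl⟩, rfl⟩ := hx
      refine Submodule.mem_iSup_of_mem ⟨l, hl⟩ ⟨z, ?_⟩
      rw [hT, hl0, zero_smul, sub_zero]
      rfl
    | zero => rw [map_zero, zero_smul]; exact zero_mem _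
    | add x y _ _ hx hy => rw [map_add, add_smul]; exact add_mem hx hy
    | smul r x _ hx => rw [map_smul, smul_assoc]; exact Submodule.smul_mem _ r hx
  set M : Submodule K Z := ⨆ i, LinearMap.range (T i) with hM
  have engel : ∀ W : Submodule K Z, (∀ i, ∀ w ∈ W, T i w ∈ W) → W ⊔ M = ⊤ → W = ⊤ := by
    intro W hW htop
    refine eq_top_of_sup_iSup_range_eq_top T d hTnil hTcomm W hW Finset.univ
      (fun _ _ _ _ => Finset.mem_univ _) ?_
    simpa using htop
  -- This is the Engel statement for W = 0, as `Z` is nonzero.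
  have hMtop : M ≠ ⊤ := by
    intro h
    have := engel ⊥ (fun i w hw => by rw [(Submodule.mem_bot K).1 hw, map_zero]; exact zero_mem _)
      (by rw [h, bot_sup_eq])
    exact bot_ne_top this
  -- the span of the vectors obtained from `v` by applying words in the `f i`
  let W : Submodule K Z :=
    Submodule.span K (Set.range fun l : List ι => (l.map fun i => D (f i)).prod • v)
  have hvW : v ∈ W := Submodule.subset_span ⟨[], by simp⟩
  have hWf : ∀ i, ∀ w ∈ W, D (f i) • w ∈ W := by
    intro i w hw
    induction hw using Submodule.span_induction with
    | mem w hw =>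
      obtain ⟨l, rfl⟩ := hw
      refine Submodule.subset_span ⟨i :: l, ?_⟩
      simp [mul_smul]
    | zero => rw [smul_zero]; exact zero_mem _
    | add x y _ _ hx hy => rw [smul_add]; exact add_mem hx hy
    | smul r x _ hx => rw [smul_comm]; exact Submodule.smul_mem _ r hx
  have hWg : ∀ x, ∀ w ∈ W, D x • w ∈ W := by
    intro x w hw
    induction hw using Submodule.span_induction with
    | mem w hw =>
      obtain ⟨l, rfl⟩ := hw
      change D x • (l.map fun i => D (f i)).prod • v ∈ W
      -- Moving `x` past `f i` leaves `⁅x, f i⁆` acting on the shorter word, so the induction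
      -- hypothesis is needed for all `x` at once.
      induction l generalizing x with
      | nil =>
        have h1 : Submodule.span K ({v} ∪ Set.range fun i => D (f i) • v) ≤ W := by
          rw [Submodule.span_le]
          rintro _ (rfl | ⟨i, rfl⟩)
          · exact hvW
          · exact hWf i v hvW
        rw [List.map_nil, List.prod_nil, one_smul]
        exact h1 (hspan x)
      | cons i l ih =>
        rw [List.map_cons, List.prod_cons, mul_smul, ← mul_smul, hD, add_smul, mul_smul]
        exact add_mem (hWf i _ (ih x)) (ih _)
    | zero => rw [smul_zero]; exact zero_mem _
    | add x y _ _ hx hy => rw [smul_add]; exact add_mem hx hy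
    | smul r x _ hx => rw [smul_comm]; exact Submodule.smul_mem _ r hx
  have hWA : ∀ a : A, ∀ w ∈ W, a • w ∈ W := by
    intro a
    obtain ⟨u, rfl⟩ := hφ a
    have hu : u ∈ Algebra.adjoin K (Set.range (UniversalEnvelopingAlgebra.ι K (L := L))) :=
      adjoin_range_ι K L ▸ Algebra.mem_top
    induction hu using Algebra.adjoin_induction with
    | mem u hu => obtain ⟨x, rfl⟩ := hu; exact hWg x
    | algebraMap r =>
      intro w hw
      rw [AlgHom.commutes, algebraMap_smul]
      exact Submodule.smul_mem _ r hw
    | add x y _ _ hx hy =>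
      intro w hw
      rw [map_add, add_smul]; exact add_mem (hx w hw) (hy w hw)
    | mul x y _ _ hx hy =>
      intro w hw
      rw [map_mul, mul_smul]; exact hx _ (hy w hw)
  have hWtop : ∀ z, z ∈ W := by
    intro z
    have hz : z ∈ Submodule.span A {v} := hv ▸ Submodule.mem_top
    obtain ⟨a, rfl⟩ := Submodule.mem_span_singleton.1 hz
    exact hWA a v hvW
  have hWM : W ≤ Submodule.span K {v} ⊔ M := by
    rw [Submodule.span_le]
    rintro _ ⟨l, rfl⟩
    change (l.map fun i => D (f i)).prod • v ∈ Submodule.span K {v} ⊔ M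
    induction l with
    | nil => exact Submodule.mem_sup_left (by simp)
    | cons i l ih =>
      rw [List.map_cons, List.prod_cons, mul_smul]
      have h1 := hT i ((l.map fun i => D (f i)).prod • v)
      rw [eq_sub_iff_add_eq] at h1
      rw [← h1]
      exact add_mem (Submodule.mem_sup_right (Submodule.mem_iSup_of_mem i ⟨_, rfl⟩))
        (Submodule.smul_mem _ _ ih)
  refine isSimpleModule_quotient_maxSubmodule_of_le M.toAddSubgroup
    (fun h => hMtop (Submodule.toAddSubgroup_injective h)) fun N hN => ?_
  by_contra hle
  obtain ⟨n, hn, hnM⟩ := Set.not_subset.1 hle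
  have hN' : ∀ x, x ∈ N.restrictScalars K ↔ x ∈ N := fun x => Iff.rfl
  apply hN
  have key : N.restrictScalars K = ⊤ := by
    refine engel _ (fun i w hw => N.smul_mem _ hw) ?_
    -- An element of `N` outside `M` has a nonzero component along `v`, which puts `v`, and with it
    -- everything, in N + M.
    obtain ⟨x, hx, m, hm, hxm⟩ := Submodule.mem_sup.1 (hWM (hWtop n))
    obtain ⟨r, rfl⟩ := Submodule.mem_span_singleton.1 hx
    have hr : r ≠ 0 := by
      rintro rfl
      rw [zero_smul, zero_add] at hxm
      exact hnM (hxm ▸ hm)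
    have hvN : v ∈ N.restrictScalars K ⊔ M := by
      have h1 : r • v = n - m := eq_sub_of_add_eq hxm
      have h2 : v = r⁻¹ • (n - m) := by rw [← h1, inv_smul_smul₀ hr]
      rw [h2]
      exact Submodule.smul_mem _ _ (sub_mem (Submodule.mem_sup_left hn) (Submodule.mem_sup_right hm))
    rw [eq_top_iff]
    intro z _
    refine (sup_le ?_ le_sup_right : Submodule.span K {v} ⊔ M ≤ _) (hWM (hWtop z))
    rw [Submodule.span_singleton_le_iff_mem]
    exact hvN
  rw [eq_top_iff]
  intro z _
  exact (hN' z).1 (key ▸ Submodule.mem_top)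

end Generic

end ModularReduction

/-! ### The highest weight vector over ℂ, over R and over K. -/

namespace ModularReduction

theorem span_range_mk_eq_top {R M ι : Type*} [Ring R] [AddCommGroup M] [Module R M] (f : ι → M) :
    Submodule.span R (Set.range fun i =>
      (⟨f i, Submodule.subset_span ⟨i, rfl⟩⟩ : Submodule.span R (Set.range f))) = ⊤ := by
  have h : (Set.range fun i =>
      (⟨f i, Submodule.subset_span ⟨i, rfl⟩⟩ : Submodule.span R (Set.range f))) =
      ((↑) : Submodule.span R (Set.range f) → M) ⁻¹' Set.range f := by
    ext x
    constructor
    · rintro ⟨i, rfl⟩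
      exact ⟨i, rfl⟩
    · rintro ⟨i, hi⟩
      exact ⟨i, Subtype.ext hi⟩
  rw [h]
  exact Submodule.span_span_coe_preimage

namespace IntegralFrame

variable {ι g : Type*} [LieRing g] [LieAlgebra ℂ g] (F : IntegralFrame ι g)

theorem smul_highestWeightVector_of_mem (μ : Module.Dual ℂ (F.partC 0))
    {u : UniversalEnvelopingAlgebra ℂ g} (hu : u ∈ F.vermaIdeal μ) :
    u • F.highestWeightVector μ = 0 := by
  have h : u • (Submodule.Quotient.mk 1 : F.Verma μ) = 0 := by
    rw [← Submodule.Quotient.mk_smul, smul_eq_mul, mul_one]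
    exact (Submodule.Quotient.mk_eq_zero _).2 hu
  change u • Submodule.Quotient.mk _ = _
  rw [← Submodule.Quotient.mk_smul, h]
  rfl

theorem ι_smul_highestWeightVector_of_pos (μ : Module.Dual ℂ (F.partC 0)) {x : g}
    (hx : x ∈ F.partC 1) :
    UniversalEnvelopingAlgebra.ι ℂ x • F.highestWeightVector μ = 0 :=
  F.smul_highestWeightVector_of_mem μ (Ideal.subset_span (Or.inl ⟨x, hx, rfl⟩))

theorem ι_smul_highestWeightVector_of_zero (μ : Module.Dual ℂ (F.partC 0)) (h : F.partC 0) :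
    UniversalEnvelopingAlgebra.ι ℂ (h : g) • F.highestWeightVector μ =
      algebraMap ℂ (UniversalEnvelopingAlgebra ℂ g) (μ h) • F.highestWeightVector μ := by
  rw [← sub_eq_zero, ← sub_smul]
  exact F.smul_highestWeightVector_of_mem μ (Ideal.subset_span (Or.inr ⟨h, rfl⟩))

section OverR

variable (R : Type*) [CommRing R] [Algebra R ℂ] [LieAlgebra R g] [IsScalarTower R ℂ g]

/-- The highest weight vector as an element of `L_R(λ)`. -/
def highestWeightVectorR (lam : Module.Dual R (F.partR R 0)) : F.LR R lam :=
  ⟨F.highestWeightVectorRes R (F.extendC R lam), 1, by rw [map_one]; rfl⟩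

theorem lie_highestWeightVectorR_of_pos (lam : Module.Dual R (F.partR R 0)) (x : F.partR R 1) :
    ⁅(x : F.gR R), F.highestWeightVectorR R lam⁆ = 0 := by
  obtain ⟨x, hx⟩ := x
  change ⁅x, F.highestWeightVectorR R lam⁆ = 0
  rw [partR] at hx
  induction hx using Submodule.span_induction with
  | mem x hx =>
    obtain ⟨i, rfl⟩ := hx
    exact Subtype.ext (F.ι_smul_highestWeightVector_of_pos _ (Submodule.subset_span ⟨i, rfl⟩))
  | zero => exact zero_lie _
  | add x y _ _ hx hy => rw [add_lie, hx, hy, add_zero]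
  | smul r x _ hx => rw [smul_lie, hx, smul_zero]

theorem extendC_basis (lam : Module.Dual R (F.partR R 0)) (i : {i // F.sgn i = 0}) :
    F.extendC R lam ⟨F.basis i, Submodule.subset_span ⟨i, rfl⟩⟩ =
      algebraMap R ℂ (lam ⟨F.basisElt R i, Submodule.subset_span ⟨i, rfl⟩⟩) := by
  have hli := F.basis.linearIndependent.comp (Subtype.val : {i // F.sgn i = 0} → ι)
    Subtype.val_injective
  have h : (⟨F.basis i, Submodule.subset_span ⟨i, rfl⟩⟩ : F.partC 0) =
      Module.Basis.span hli i := (Module.Basis.span_apply hli i).symm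
  rw [h]
  exact (Module.Basis.span hli).constr_basis ℂ _ i

/-- Both sides are linear in `h`, and on 𝓑⁰ the extended weight `extendC` takes the values of `lam`.
-/
theorem lie_highestWeightVectorR_of_zero (lam : Module.Dual R (F.partR R 0)) (h : F.partR R 0) :
    ⁅(h : F.gR R), F.highestWeightVectorR R lam⁆ = lam h • F.highestWeightVectorR R lam := by
  have hh : h ∈ (⊤ : Submodule R (F.partR R 0)) := Submodule.mem_top
  have hs : Submodule.span R (Set.range fun i : {i // F.sgn i = 0} =>
      (⟨F.basisElt R i, Submodule.subset_span ⟨i, rfl⟩⟩ : F.partR R 0)) = ⊤ :=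
    span_range_mk_eq_top _
  rw [← hs] at hh
  induction hh using Submodule.span_induction with
  | mem x hx =>
    obtain ⟨i, rfl⟩ := hx
    refine Subtype.ext ((F.ι_smul_highestWeightVector_of_zero (F.extendC R lam)
      ⟨F.basis i, Submodule.subset_span ⟨i, rfl⟩⟩).trans ?_)
    rw [extendC_basis]
    exact (F.smul_eq_algebraMap_smul R _ _ _).symm
  | zero => rw [map_zero, zero_smul]; exact zero_lie _
  | add x y _ _ hx hy => rw [map_add, add_smul, ← hx, ← hy]; exact add_lie _ _ _
  | smul r x _ hx => rw [map_smul, smul_assoc, ← hx]; exact smul_lie _ _ _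

theorem span_basisElt : Submodule.span R (Set.range (F.basisElt R)) = ⊤ :=
  span_range_mk_eq_top F.basis

section OverK

variable (K : Type*) [Field K] [Algebra R K]

theorem span_one_tmul_basisElt :
    Submodule.span K (Set.range fun i => (1 ⊗ₜ F.basisElt R i : F.gK R K)) = ⊤ := by
  have h := Submodule.baseChange_span (R := R) (M := F.gR R) (A := K) (Set.range (F.basisElt R))
  rw [span_basisElt, Submodule.baseChange_top] at h
  rw [h]
  congr 1
  rw [← Set.range_comp]
  rfl

/-- Expansions in the basis with integral coefficients survive the reduction to `K`. -/
theorem one_tmul_mem_span {x : F.gR R} {s : Set ι}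
    (hx : (x : g) ∈ Submodule.span ℤ (F.basis '' s)) :
    (1 ⊗ₜ x : F.gK R K) ∈ Submodule.span K ((fun i => (1 ⊗ₜ F.basisElt R i : F.gK R K)) '' s) := by
  -- The expansion must be lifted from `g` to `gR` before tensoring; the lift is unique because `gR`
  -- is a subset of `g`.
  have key : ∀ y ∈ Submodule.span ℤ (F.basis '' s), ∃ x : F.gR R, (x : g) = y ∧
      (1 ⊗ₜ x : F.gK R K) ∈
        Submodule.span K ((fun i => (1 ⊗ₜ F.basisElt R i : F.gK R K)) '' s) := by
    intro y hy
    induction hy using Submodule.span_induction with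
    | mem y hy =>
      obtain ⟨i, hi, rfl⟩ := hy
      exact ⟨F.basisElt R i, rfl, Submodule.subset_span ⟨i, hi, rfl⟩⟩
    | zero => exact ⟨0, rfl, by rw [TensorProduct.tmul_zero]; exact zero_mem _⟩
    | add y z _ _ hy hz =>
      obtain ⟨a, ha, ha'⟩ := hy
      obtain ⟨b, hb, hb'⟩ := hz
      refine ⟨a + b, ?_, ?_⟩
      · rw [← ha, ← hb]; rfl
      · rw [TensorProduct.tmul_add]; exact add_mem ha' hb'
    | smul n y _ hy =>
      obtain ⟨a, ha, ha'⟩ := hy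
      refine ⟨n • a, ?_, ?_⟩
      · rw [← ha]; rfl
      · rw [TensorProduct.tmul_smul]; exact zsmul_mem ha' n
  obtain ⟨x', hx', h⟩ := key _ hx
  rwa [Subtype.ext hx'] at h

/-- The highest weight vector `v̄ ⊗ 1` of `L_p(λ)`. -/
def highestWeightVectorP (lam : Module.Dual R (F.partR R 0)) : F.Lp R K lam :=
  (1 ⊗ₜ F.highestWeightVectorR R lam : K ⊗[R] F.LR R lam)

theorem ι_smul_Lp (lam : Module.Dual R (F.partR R 0)) (x : F.gK R K) (m : K ⊗[R] F.LR R lam) :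
    (UniversalEnvelopingAlgebra.ι K x • (show F.Lp R K lam from m) : F.Lp R K lam) =
      (⁅x, m⁆ : K ⊗[R] F.LR R lam) := by
  change UniversalEnvelopingAlgebra.lift K (LieModule.toEnd K (F.gK R K) (K ⊗[R] F.LR R lam))
    (UniversalEnvelopingAlgebra.ι K x) m = _
  rw [UniversalEnvelopingAlgebra.lift_ι_apply]
  rfl

theorem algebraMap_smul_Lp (lam : Module.Dual R (F.partR R 0)) (c : K) (m : K ⊗[R] F.LR R lam) :
    (algebraMap K (UniversalEnvelopingAlgebra K (F.gK R K)) c •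
      (show F.Lp R K lam from m) : F.Lp R K lam) = (c • m : K ⊗[R] F.LR R lam) := by
  change UniversalEnvelopingAlgebra.lift K (LieModule.toEnd K (F.gK R K) (K ⊗[R] F.LR R lam))
    (algebraMap K (UniversalEnvelopingAlgebra K (F.gK R K)) c) m = _
  rw [AlgHom.commutes]
  rfl

/-- Every element of L_R(λ) is some u v̄ with u in U(𝔤_R), and a submodule containing 1 ⊗ m contains
1 ⊗ u m, by induction on the generators of U(𝔤_R). Scalars of K give the remaining tensors. -/
theorem span_highestWeightVectorP (lam : Module.Dual R (F.partR R 0)) :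
    Submodule.span (UniversalEnvelopingAlgebra K (F.gK R K)) {F.highestWeightVectorP R K lam} =
      ⊤ := by
  set N := Submodule.span (UniversalEnvelopingAlgebra K (F.gK R K))
    {F.highestWeightVectorP R K lam} with hN
  have hLR : ∀ u : UniversalEnvelopingAlgebra R (F.gR R), ∀ m : F.LR R lam,
      (show F.Lp R K lam from (1 ⊗ₜ m : K ⊗[R] F.LR R lam)) ∈ N →
      (show F.Lp R K lam from (1 ⊗ₜ (UniversalEnvelopingAlgebra.lift R
        (LieModule.toEnd R (F.gR R) (F.LR R lam)) u m) : K ⊗[R] F.LR R lam)) ∈ N := by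
    intro u
    have hu : u ∈ Algebra.adjoin R (Set.range (UniversalEnvelopingAlgebra.ι R (L := F.gR R))) :=
      adjoin_range_ι R (F.gR R) ▸ Algebra.mem_top
    induction hu using Algebra.adjoin_induction with
    | mem u hu =>
      obtain ⟨x, rfl⟩ := hu
      intro m hm
      have h := N.smul_mem (UniversalEnvelopingAlgebra.ι K (1 ⊗ₜ x : F.gK R K)) hm
      rw [ι_smul_Lp, LieAlgebra.ExtendScalars.bracket_tmul, one_mul] at h
      rwa [UniversalEnvelopingAlgebra.lift_ι_apply]
    | algebraMap r =>
      intro m hm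
      have h := N.smul_mem (algebraMap K (UniversalEnvelopingAlgebra K (F.gK R K))
        (algebraMap R K r)) hm
      rw [algebraMap_smul_Lp, algebraMap_smul, ← TensorProduct.tmul_smul] at h
      rw [AlgHom.commutes]
      exact h
    | add x y _ _ hx hy =>
      intro m hm
      rw [map_add, LinearMap.add_apply, TensorProduct.tmul_add]
      exact N.add_mem (hx m hm) (hy m hm)
    | mul x y _ _ hx hy =>
      intro m hm
      rw [map_mul]
      exact hx _ (hy m hm)
  -- Membership in L_R(λ) is expressed by the action on L_ℂ(λ), so this action has to be matched
  -- with the one on the submodule.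
  have hcoe : ∀ u : UniversalEnvelopingAlgebra R (F.gR R), ∀ m : F.LR R lam,
      ((UniversalEnvelopingAlgebra.lift R (LieModule.toEnd R (F.gR R) (F.LR R lam)) u m :
        F.LR R lam) : F.SimpleCRes R (F.extendC R lam)) =
      UniversalEnvelopingAlgebra.lift R
        (LieModule.toEnd R (F.gR R) (F.SimpleCRes R (F.extendC R lam))) u m := by
    intro u
    have hu : u ∈ Algebra.adjoin R (Set.range (UniversalEnvelopingAlgebra.ι R (L := F.gR R))) :=
      adjoin_range_ι R (F.gR R) ▸ Algebra.mem_top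
    induction hu using Algebra.adjoin_induction with
    | mem u hu =>
      obtain ⟨x, rfl⟩ := hu
      intro m
      rw [UniversalEnvelopingAlgebra.lift_ι_apply, UniversalEnvelopingAlgebra.lift_ι_apply]
      rfl
    | algebraMap r =>
      intro m
      rw [AlgHom.commutes, AlgHom.commutes]
      rfl
    | add x y _ _ hx hy =>
      intro m
      rw [map_add, map_add, LinearMap.add_apply, LinearMap.add_apply, ← hx, ← hy]
      rfl
    | mul x y _ _ hx hy =>
      intro m
      rw [map_mul, map_mul, Module.End.mul_apply, Module.End.mul_apply, hx, hy]
  have hv : (show F.Lp R K lam from (1 ⊗ₜ F.highestWeightVectorR R lam : K ⊗[R] F.LR R lam)) ∈ N :=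
    Submodule.mem_span_singleton_self _
  rw [eq_top_iff]
  intro m _
  change K ⊗[R] F.LR R lam at m
  induction m using TensorProduct.induction_on with
  | zero => exact N.zero_mem
  | tmul c m =>
    obtain ⟨m, u, hm⟩ := m
    have e : (⟨m, u, hm⟩ : F.LR R lam) = UniversalEnvelopingAlgebra.lift R
        (LieModule.toEnd R (F.gR R) (F.LR R lam)) u (F.highestWeightVectorR R lam) :=
      Subtype.ext (hm.trans (hcoe u (F.highestWeightVectorR R lam)).symm)
    have h := N.smul_mem (algebraMap K (UniversalEnvelopingAlgebra K (F.gK R K)) c) (hLR u _ hv)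
    rw [algebraMap_smul_Lp, TensorProduct.smul_tmul', smul_eq_mul, mul_one] at h
    rw [e]
    exact h
  | add x y hx hy => exact N.add_mem (hx trivial) (hy trivial)

theorem ι_smul_highestWeightVectorP_of_pos (lam : Module.Dual R (F.partR R 0))
    (x : K ⊗[R] F.partR R 1) :
    UniversalEnvelopingAlgebra.ι K ((F.partR R 1).subtype.baseChange K x) •
      F.highestWeightVectorP R K lam = 0 := by
  refine (F.ι_smul_Lp R K lam _ _).trans ?_
  change ⁅_, (1 ⊗ₜ F.highestWeightVectorR R lam : K ⊗[R] F.LR R lam)⁆ = (0 : K ⊗[R] F.LR R lam)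
  induction x using TensorProduct.induction_on with
  | zero => rw [map_zero]; exact zero_lie _
  | tmul c x =>
    rw [LinearMap.baseChange_tmul, LieAlgebra.ExtendScalars.bracket_tmul, Submodule.subtype_apply,
      lie_highestWeightVectorR_of_pos, TensorProduct.tmul_zero]
  | add x y hx hy => rw [map_add, add_lie, hx, hy]; exact add_zero _

theorem ι_smul_highestWeightVectorP_of_zero (lam : Module.Dual R (F.partR R 0))
    (h : K ⊗[R] F.partR R 0) :
    UniversalEnvelopingAlgebra.ι K ((F.partR R 0).subtype.baseChange K h) •
      F.highestWeightVectorP R K lam =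
      algebraMap K (UniversalEnvelopingAlgebra K (F.gK R K)) (F.tilde R K lam h) •
        F.highestWeightVectorP R K lam := by
  refine (F.ι_smul_Lp R K lam _ _).trans
    (Eq.trans ?_ (F.algebraMap_smul_Lp R K lam _ _).symm)
  change ⁅_, (1 ⊗ₜ F.highestWeightVectorR R lam : K ⊗[R] F.LR R lam)⁆ =
    F.tilde R K lam _ • (1 ⊗ₜ F.highestWeightVectorR R lam : K ⊗[R] F.LR R lam)
  induction h using TensorProduct.induction_on with
  | zero => rw [map_zero, map_zero, zero_smul]; exact zero_lie _
  | tmul c x =>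
    rw [LinearMap.baseChange_tmul, LieAlgebra.ExtendScalars.bracket_tmul, Submodule.subtype_apply,
      lie_highestWeightVectorR_of_zero, tilde, Module.Dual.baseChange_apply_tmul,
      TensorProduct.tmul_smul, TensorProduct.smul_tmul', TensorProduct.smul_tmul', mul_one,
      smul_eq_mul, mul_one, Algebra.smul_def]
  | add x y hx hy => rw [map_add, map_add, add_smul, add_lie, hx, hy]

end OverK

end OverR

end IntegralFrame

end ModularReduction

/-! ### Baby Verma modules and reduced enveloping algebras. -/

namespace ModularReduction

/-- The kernel of `f` is proper because its target is nonzero, hence it lies in the sum of all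
proper submodules, and the projection factors through `M`. -/
theorem exists_surjective_quotient_maxSubmodule {A Z M : Type*} [Ring A] [AddCommGroup Z]
    [Module A Z] [AddCommGroup M] [Module A M] [Nontrivial M] (f : Z →ₗ[A] M)
    (hf : Function.Surjective f) :
    ∃ h : M →ₗ[A] Z ⧸ maxSubmodule A Z, Function.Surjective h := by
  have hker : LinearMap.ker f ≠ ⊤ := by
    intro h
    rw [LinearMap.ker_eq_top] at h
    obtain ⟨m, hm⟩ := exists_ne (0 : M)
    obtain ⟨z, rfl⟩ := hf m
    exact hm (by rw [h, LinearMap.zero_apply])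
  have hle : LinearMap.ker f ≤ maxSubmodule A Z := le_sSup hker
  let e := f.quotKerEquivOfSurjective hf
  refine ⟨(Submodule.factor hle).comp e.symm.toLinearMap, ?_⟩
  exact (Submodule.factor_surjective hle).comp e.symm.surjective

namespace IntegralFrame

variable {ι g : Type*} [LieRing g] [LieAlgebra ℂ g] (F : IntegralFrame ι g)
  (R : Type*) [CommRing R] [Algebra R ℂ] [LieAlgebra R g] [IsScalarTower R ℂ g]
  (K : Type*) [Field K] [Algebra R K]
  (p : ℕ) (pMap : F.gK R K → F.gK R K) (chi : Module.Dual K (F.gK R K))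

/-- The image of `v̄ ⊗ 1` in `L_p^χ(λ)`. -/
def highestWeightVectorChi (lam : Module.Dual R (F.partR R 0)) : F.Lpchi R K p pMap chi lam :=
  Submodule.Quotient.mk (F.highestWeightVectorP R K lam)

theorem mk_smul_highestWeightVectorChi (lam : Module.Dual R (F.partR R 0))
    (u : UniversalEnvelopingAlgebra K (F.gK R K)) :
    Ideal.Quotient.mk (F.J R K p pMap chi) u • F.highestWeightVectorChi R K p pMap chi lam =
      Submodule.Quotient.mk (u • F.highestWeightVectorP R K lam) := rfl

/-- The homomorphism `Z_χ(λ̃) → L_p^χ(λ)` between the highest weight vectors. -/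
def babyVermaToLpchi (lam : Module.Dual R (F.partR R 0)) :
    F.BabyVerma R K p pMap chi (F.tilde R K lam) →ₗ[F.Uchi R K p pMap chi]
      F.Lpchi R K p pMap chi lam :=
  Submodule.liftQ _ (LinearMap.toSpanSingleton (F.Uchi R K p pMap chi) _
    (F.highestWeightVectorChi R K p pMap chi lam)) <| by
    rw [babyVermaIdeal, Ideal.span, Submodule.span_le]
    rintro _ (⟨x, rfl⟩ | ⟨h, rfl⟩)
    · refine (F.mk_smul_highestWeightVectorChi R K p pMap chi lam _).trans ?_
      rw [ι_smul_highestWeightVectorP_of_pos]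
      exact Submodule.Quotient.mk_zero _
    · refine (F.mk_smul_highestWeightVectorChi R K p pMap chi lam _).trans ?_
      rw [sub_smul, ι_smul_highestWeightVectorP_of_zero, sub_self]
      exact Submodule.Quotient.mk_zero _

theorem babyVermaToLpchi_surjective (lam : Module.Dual R (F.partR R 0)) :
    Function.Surjective (F.babyVermaToLpchi R K p pMap chi lam) := by
  intro m
  obtain ⟨m, rfl⟩ := Submodule.Quotient.mk_surjective _ m
  have hm : m ∈ Submodule.span (UniversalEnvelopingAlgebra K (F.gK R K))
      {F.highestWeightVectorP R K lam} :=
    F.span_highestWeightVectorP R K lam ▸ Submodule.mem_top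
  obtain ⟨u, rfl⟩ := Submodule.mem_span_singleton.1 hm
  exact ⟨Submodule.Quotient.mk (Ideal.Quotient.mk _ u), rfl⟩

theorem mk_ι_pow (x : F.gK R K) :
    Ideal.Quotient.mkₐ K (F.J R K p pMap chi) (UniversalEnvelopingAlgebra.ι K x) ^ p =
      Ideal.Quotient.mkₐ K (F.J R K p pMap chi) (UniversalEnvelopingAlgebra.ι K (pMap x)) +
      algebraMap K (F.Uchi R K p pMap chi) (chi x ^ p) := by
  rw [← sub_eq_zero, ← sub_sub, ← map_pow, ← map_sub,
    ← AlgHom.commutes (Ideal.Quotient.mkₐ K (F.J R K p pMap chi)), ← map_sub]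
  refine Ideal.Quotient.eq_zero_iff_mem.2 ?_
  exact TwoSidedIdeal.mem_asIdeal.2 (TwoSidedIdeal.subset_span ⟨x, rfl⟩)

/-- If x^{[p]} = 0, the defining relation reads x^p = χ(x)^p, and taking p-th powers is additive on
commuting elements in characteristic p. -/
theorem isNilpotent_mk_ι_sub [Fact p.Prime] [CharP K p] {x : F.gK R K} (hx : pMap x = 0) :
    IsNilpotent (Ideal.Quotient.mkₐ K (F.J R K p pMap chi) (UniversalEnvelopingAlgebra.ι K x) -
      algebraMap K (F.Uchi R K p pMap chi) (chi x)) := by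
  set y := Ideal.Quotient.mkₐ K (F.J R K p pMap chi) (UniversalEnvelopingAlgebra.ι K x) with hy
  refine ⟨p, ?_⟩
  have hcomm : Commute (y - algebraMap K (F.Uchi R K p pMap chi) (chi x))
      (algebraMap K (F.Uchi R K p pMap chi) (chi x)) := (Algebra.commutes _ _).symm
  obtain ⟨r, hr⟩ := hcomm.exists_add_pow_prime_eq (Fact.out : p.Prime)
  have hp : (p : F.Uchi R K p pMap chi) = 0 := by
    rw [← map_natCast (algebraMap K (F.Uchi R K p pMap chi)), CharP.cast_eq_zero, map_zero]
  rw [hp, zero_mul, zero_mul, zero_mul, add_zero, sub_add_cancel, hy, mk_ι_pow, hx, map_zero,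
    map_zero, zero_add, map_pow] at hr
  exact left_eq_add.1 ((add_comm _ _).trans hr.symm).symm

/-- The common core of both cases. What remains for each Lie algebra is the vanishing of e^{[p]} on
negative root vectors and a depth function `d` that grows strictly under brackets, these brackets
avoiding the simple root vectors. -/
theorem exists_surjective_of_pMap_eq_zero [Finite ι] [Fact p.Prime] [CharP K p]
    (hchi : F.IsStandardLevi R K chi) (d : ι → ℕ)
    (hpMap : ∀ i, F.sgn i = -1 → pMap (1 ⊗ₜ F.basisElt R i) = 0)
    (hlie : ∀ i j, F.sgn i = -1 → F.sgn j = -1 → ⁅F.basis i, F.basis j⁆ ∈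
      Submodule.span ℤ (F.basis '' {l | F.sgn l = -1 ∧ l ∉ F.negSimple ∧ d i < d l ∧ d j < d l}))
    (lam : Module.Dual R (F.partR R 0)) [Nontrivial (F.Lpchi R K p pMap chi lam)] :
    IsSimpleModule (F.Uchi R K p pMap chi) (F.Lchi R K p pMap chi (F.tilde R K lam)) ∧
      ∃ f : F.Lpchi R K p pMap chi lam →ₗ[F.Uchi R K p pMap chi]
        F.Lchi R K p pMap chi (F.tilde R K lam), Function.Surjective f := by
  have hsurj := F.babyVermaToLpchi_surjective R K p pMap chi lam
  constructor
  · have : Nontrivial (F.BabyVerma R K p pMap chi (F.tilde R K lam)) := hsurj.nontrivial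
    obtain ⟨hchi0, I, hI, hchiI⟩ := hchi
    have hmk : ∀ a : F.Uchi R K p pMap chi, a ∈ F.babyVermaIdeal R K p pMap chi (F.tilde R K lam) →
        a • (Submodule.Quotient.mk 1 : F.BabyVerma R K p pMap chi (F.tilde R K lam)) = 0 := by
      intro a ha
      rw [← Submodule.Quotient.mk_smul, smul_eq_mul, mul_one]
      exact (Submodule.Quotient.mk_eq_zero _).2 ha
    have hmk0 := fun h : K ⊗[R] F.partR R 0 => hmk _ (Ideal.subset_span (Or.inr ⟨h, rfl⟩))
    have hmk1 := fun x : K ⊗[R] F.partR R 1 => hmk _ (Ideal.subset_span (Or.inl ⟨x, rfl⟩))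
    refine isSimpleModule_quotient_maxSubmodule (K := K) (L := F.gK R K)
      (ι := {i // F.sgn i = -1}) (Ideal.Quotient.mkₐ K (F.J R K p pMap chi))
      (Ideal.Quotient.mkₐ_surjective _ _) (Submodule.Quotient.mk 1) ?_
      (fun i => 1 ⊗ₜ F.basisElt R i) (fun i => chi (1 ⊗ₜ F.basisElt R i)) (fun i => d i) ?_
      (fun i => F.isNilpotent_mk_ι_sub R K p pMap chi (hpMap i i.2)) ?_
    · rw [eq_top_iff]
      intro z _
      obtain ⟨a, rfl⟩ := Submodule.Quotient.mk_surjective _ z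
      refine Submodule.mem_span_singleton.2 ⟨a, ?_⟩
      rw [← Submodule.Quotient.mk_smul, smul_eq_mul, mul_one]
    · intro x
      have hx : x ∈ Submodule.span K (Set.range fun i => (1 ⊗ₜ F.basisElt R i : F.gK R K)) :=
        F.span_one_tmul_basisElt R K ▸ Submodule.mem_top
      induction hx using Submodule.span_induction with
      | mem x hx =>
        obtain ⟨i, rfl⟩ := hx
        -- The cases are 0, -1, 1: a toral element acts on the generator by a scalar, a negative
        -- root vector is one of the chosen operators, and a positive one gives zero.
        rcases hs : F.sgn i with _ | _ | _
        · have h1 := hmk0 (1 ⊗ₜ ⟨F.basisElt R i, Submodule.subset_span ⟨⟨i, hs⟩, rfl⟩⟩)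
          rw [map_sub, sub_smul, sub_eq_zero] at h1
          refine (congrArg (· ∈ _) h1).mpr ?_
          have h2 : ∀ c : K, Ideal.Quotient.mk (F.J R K p pMap chi)
              (algebraMap K (UniversalEnvelopingAlgebra K (F.gK R K)) c) •
              (Submodule.Quotient.mk 1 : F.BabyVerma R K p pMap chi (F.tilde R K lam)) =
              c • Submodule.Quotient.mk 1 := fun c =>
            algebraMap_smul (F.Uchi R K p pMap chi) c _
          rw [h2]
          exact Submodule.smul_mem _ _ (Submodule.subset_span (Or.inl rfl))
        · exact Submodule.subset_span (Or.inr ⟨⟨i, hs⟩, rfl⟩)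
        · have h1 := hmk1 (1 ⊗ₜ ⟨F.basisElt R i, Submodule.subset_span ⟨⟨i, hs⟩, rfl⟩⟩)
          exact (congrArg (· ∈ _) h1).mpr (zero_mem _)
      | zero => rw [map_zero, map_zero, zero_smul]; exact zero_mem _
      | add x y _ _ hx hy => rw [map_add, map_add, add_smul]; exact add_mem hx hy
      | smul r x _ hx => rw [map_smul, map_smul, smul_assoc]; exact Submodule.smul_mem _ r hx
    · intro i j
      have h := F.one_tmul_mem_span R K (x := ⁅F.basisElt R i, F.basisElt R j⁆)
        (hlie i j i.2 j.2)
      rw [LieAlgebra.ExtendScalars.bracket_tmul, one_mul]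
      refine Submodule.span_mono ?_ h
      rintro _ ⟨l, ⟨hl, hlI, hdi, hdj⟩, rfl⟩
      -- The support I of χ consists of simple indices, so χ vanishes at `l`.
      exact ⟨⟨l, hl⟩, ⟨(hchiI l hl).2 fun h => hlI (hI h), hdi, hdj⟩, rfl⟩
  · exact exists_surjective_quotient_maxSubmodule _ hsurj

end IntegralFrame
end ModularReduction

/-! ### The restricted structure and the depth function for gl_N. -/

namespace ModularReduction

/-- Injectivity makes `Function.invFun` a genuine left inverse, so its value at ρ 0 is 0 and not an
arbitrary choice. -/
theorem pMapOf_eq_zero {L A : Type*} [AddMonoid L] [Monoid A] {ρ : L → A}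
    (hρ : Function.Injective ρ) {p : ℕ} {x : L} (hx : ρ x ^ p = ρ 0) : pMapOf ρ p x = 0 := by
  rw [pMapOf, hx]
  exact Function.leftInverse_invFun hρ 0

variable (R : Type*) [CommRing R] [Algebra R ℂ] (K : Type*) [Field K] [Algebra R K]

theorem basisR_apply {ι g : Type*} [LieRing g] [LieAlgebra ℂ g] (F : IntegralFrame ι g)
    [LieAlgebra R g] [IsScalarTower R ℂ g] [FaithfulSMul R ℂ] (i : ι) :
    F.basisR R i = F.basisElt R i :=
  Module.Basis.span_apply (F.basis.linearIndependent.restrict_scalars' R) i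

variable [FaithfulSMul R ℂ]

theorem glToMatrix_basisElt (N : ℕ) (ij : Fin N × Fin N) :
    glToMatrix R K N (1 ⊗ₜ (glFrame N).basisElt R ij) = Matrix.single ij.1 ij.2 1 := by
  have h : (1 ⊗ₜ (glFrame N).basisElt R ij : (glFrame N).gK R K) =
      ((glFrame N).basisR R).baseChange K ij := by
    rw [Module.Basis.baseChange_apply, basisR_apply]
  rw [h]
  exact Module.Basis.constr_basis _ _ _ _

theorem glToMatrix_injective (N : ℕ) : Function.Injective (glToMatrix R K N) := by
  have h : glToMatrix R K N = ((((glFrame N).basisR R).baseChange K).equiv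
      (Matrix.stdBasis K (Fin N) (Fin N)) (Equiv.refl _)).toLinearMap := by
    refine (((glFrame N).basisR R).baseChange K).ext fun ij => ?_
    refine (Module.Basis.constr_basis _ _ _ _).trans ?_
    rw [LinearEquiv.coe_coe, Module.Basis.equiv_apply, Equiv.refl_apply, Matrix.stdBasis_eq_single]
  rw [h]
  exact LinearEquiv.injective _

theorem glPMap_basisElt_eq_zero (N : ℕ) {p : ℕ} (hp : 2 ≤ p) {ij : Fin N × Fin N}
    (hij : ij.1 ≠ ij.2) : glPMap R K N p (1 ⊗ₜ (glFrame N).basisElt R ij) = 0 := by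
  refine pMapOf_eq_zero (glToMatrix_injective R K N) ?_
  rw [glToMatrix_basisElt, map_zero]
  refine pow_eq_zero_of_le hp ?_
  rw [pow_two, Matrix.single_mul_single_of_ne _ _ _ _ hij.symm]

theorem glFrame_sgn_eq_neg_one_iff {N : ℕ} {ij : Fin N × Fin N} :
    (glFrame N).sgn ij = -1 ↔ (ij.2 : ℕ) < ij.1 := by
  change SignType.sign ((ij.2 : ℤ) - (ij.1 : ℤ)) = -1 ↔ _
  rw [sign_eq_neg_one_iff]
  omega

/-- A nonzero product of two strictly lower triangular matrix units is a matrix unit whose distance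
from the diagonal is the sum of theirs. This exceeds each of them and is at least 2. -/
theorem glFrame_lie_mem {N : ℕ} (i j : Fin N × Fin N) (hi : (glFrame N).sgn i = -1)
    (hj : (glFrame N).sgn j = -1) :
    ⁅(glFrame N).basis i, (glFrame N).basis j⁆ ∈ Submodule.span ℤ ((glFrame N).basis ''
      {l | (glFrame N).sgn l = -1 ∧ l ∉ (glFrame N).negSimple ∧
        (i.1 - i.2 : ℕ) < (l.1 - l.2 : ℕ) ∧ (j.1 - j.2 : ℕ) < (l.1 - l.2 : ℕ)}) := by
  obtain ⟨a, b⟩ := i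
  obtain ⟨c, d⟩ := j
  rw [glFrame_sgn_eq_neg_one_iff] at hi hj
  have hbas : ∀ a b : Fin N, (glFrame N).basis (a, b) = Matrix.single a b 1 := fun a b =>
    Matrix.stdBasis_eq_single _ _ _
  have key : ∀ a b c d e f : Fin N, (b : ℕ) < a → (d : ℕ) < c → (f : ℕ) < e →
      (a - b : ℕ) < (e - f : ℕ) → (c - d : ℕ) < (e - f : ℕ) →
      Matrix.single e f (1 : ℂ) ∈ Submodule.span ℤ ((glFrame N).basis ''
      {l | (glFrame N).sgn l = -1 ∧ l ∉ (glFrame N).negSimple ∧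
        (a - b : ℕ) < (l.1 - l.2 : ℕ) ∧ (c - d : ℕ) < (l.1 - l.2 : ℕ)}) := by
    intro a b c d e f hab hcd hef h1 h2
    refine Submodule.subset_span ⟨(e, f), ⟨glFrame_sgn_eq_neg_one_iff.2 hef, ?_, h1, h2⟩, hbas e f⟩
    change ¬ (e : ℕ) = (f : ℕ) + 1
    omega
  dsimp only at hi hj ⊢
  rw [hbas, hbas, LieRing.of_associative_ring_bracket]
  refine sub_mem ?_ ?_
  · by_cases hbc : b = c
    · subst hbc
      rw [Matrix.single_mul_single_same, mul_one]
      exact key _ _ _ _ _ _ hi hj (by omega) (by omega) (by omega)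
    · rw [Matrix.single_mul_single_of_ne _ _ _ _ hbc]
      exact zero_mem _
  · by_cases hda : d = a
    · subst hda
      rw [Matrix.single_mul_single_same, mul_one]
      exact key _ _ _ _ _ _ hi hj (by omega) (by omega) (by omega)
    · rw [Matrix.single_mul_single_of_ne _ _ _ _ hda]
      exact zero_mem _

end ModularReduction

/-! ### Powers of ad e_α on a Chevalley basis. -/

namespace ModularReduction

open LieAlgebra LieAlgebra.IsKilling

variable {g : Type*} [LieRing g] [LieAlgebra ℂ g] [FiniteDimensional ℂ g] [LieAlgebra.IsKilling ℂ g]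
  {H : LieSubalgebra ℂ g} [H.IsCartanSubalgebra]

namespace IsChevalleyBasis

variable {b : (rootSystem H).Base} {B : Module.Basis (H.root ⊕ b.support) ℂ g}

theorem lie_inr_inl (hB : IsChevalleyBasis b B) (k : b.support) (α : H.root) :
    ⁅B (.inr k), B (.inl α)⁆ = (rootSystem H).pairingIn ℤ α k • B (.inl α) := by
  have h1 := lie_eq_smul_of_mem_rootSpace (hB.root_mem α) ((rootSystem H).coroot k)
  have h2 : ⁅B (.inr k), B (.inl α)⁆ =
      ((α : LieModule.Weight ℂ H g) ((rootSystem H).coroot k)) • B (.inl α) := by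
    rw [hB.simple_coroot]
    exact h1
  rw [h2, ← Int.cast_smul_eq_zsmul ℂ]
  congr 1
  exact ((rootSystem H).algebraMap_pairingIn ℤ α k).symm

theorem lie_inr_inr (hB : IsChevalleyBasis b B) (k l : b.support) :
    ⁅B (.inr k), B (.inr l)⁆ = 0 := by
  rw [hB.simple_coroot, hB.simple_coroot, ← LieSubalgebra.coe_bracket, trivial_lie_zero,
    ZeroMemClass.coe_zero]

/-- The bracket has weight α + β. Either this is not a weight, or it is nonzero, hence a root, and
the Chevalley relation applies. Recording only divisibility absorbs the undetermined sign. -/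
theorem lie_inl_eq_zero_or (hB : IsChevalleyBasis b B) {α β : H.root}
    (h0 : (rootSystem H).root β ≠ -(rootSystem H).root α) :
    ⁅B (.inl α), B (.inl β)⁆ = 0 ∨ ∃ γ : H.root,
      (rootSystem H).root γ = (rootSystem H).root α + (rootSystem H).root β ∧
      ∃ n : ℤ, (((rootSystem H).chainBotCoeff α β + 1 : ℕ) : ℤ) ∣ n ∧
        ⁅B (.inl α), B (.inl β)⁆ = n • B (.inl γ) := by
  have hmem := LieAlgebra.lie_mem_genWeightSpace_of_mem_genWeightSpace
    (hB.root_mem α) (hB.root_mem β)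
  by_cases hbot : LieAlgebra.rootSpace H
      ((α : LieModule.Weight ℂ H g) + (β : LieModule.Weight ℂ H g) : H → ℂ) = ⊥
  · left
    have h3 : ⁅B (.inl α), B (.inl β)⁆ ∈ (⊥ : LieSubmodule ℂ H g) := hbot.le hmem
    exact (LieSubmodule.mem_bot _).1 h3
  · right
    let w : LieModule.Weight ℂ H g := ⟨_, hbot⟩
    have hw : w ∈ H.root := by
      simp only [Finset.mem_filter, Finset.mem_univ, true_and]
      intro hz
      apply h0
      ext x
      exact eq_neg_of_add_eq_zero_right (congrFun hz x)
    have hroot : (rootSystem H).root ⟨w, hw⟩ =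
      (rootSystem H).root α + (rootSystem H).root β := by ext; rfl
    refine ⟨⟨w, hw⟩, hroot, ?_⟩
    rcases hB.lie_add α β ⟨w, hw⟩ hroot with h | h
    · refine ⟨_, dvd_rfl, ?_⟩
      rw [h, Nat.cast_smul_eq_nsmul, natCast_zsmul]
    · refine ⟨_, (dvd_neg.2 dvd_rfl), ?_⟩
      rw [h, Nat.cast_smul_eq_nsmul, neg_smul, natCast_zsmul]

/-- Each application of ad e_α moves one step up the α-string, multiplies by ±(r + 1) and raises r
by one, so k steps contribute (r + 1)⋯(r + k). Linear independence is carried along to exclude ±α.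
-/
theorem ad_pow_inl_eq_zero_or (hB : IsChevalleyBasis b B) {α β : H.root}
    (h : LinearIndependent ℂ ![(rootSystem H).root α, (rootSystem H).root β]) (k : ℕ) :
    ((ad ℂ g (B (.inl α))) ^ k) (B (.inl β)) = 0 ∨ ∃ γ : H.root,
      LinearIndependent ℂ ![(rootSystem H).root α, (rootSystem H).root γ] ∧
      (rootSystem H).chainBotCoeff α γ = (rootSystem H).chainBotCoeff α β + k ∧
      ∃ n : ℤ, (((rootSystem H).chainBotCoeff α β + 1).ascFactorial k : ℤ) ∣ n ∧
        ((ad ℂ g (B (.inl α))) ^ k) (B (.inl β)) = n • B (.inl γ) := by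
  induction k with
  | zero => exact Or.inr ⟨β, h, rfl, 1, by simp, by simp⟩
  | succ k ih =>
    rw [pow_succ', Module.End.mul_apply]
    rcases ih with h0 | ⟨γ, hli, hc, n, hn, he⟩
    · left
      rw [h0, map_zero]
    · rw [he, map_zsmul, ad_apply]
      have hne : (rootSystem H).root γ ≠ -(rootSystem H).root α := by
        intro hγ
        rw [hγ, LinearIndependent.pair_iff] at hli
        simpa using hli 1 1 (by simp)
      rcases hB.lie_inl_eq_zero_or hne with h0 | ⟨δ, hδ, m, hm, hl⟩
      · left
        rw [h0, smul_zero]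
      · right
        refine ⟨δ, by simpa [hδ], ?_, n * m, ?_, ?_⟩
        · rw [(rootSystem H).chainBotCoeff_of_add hli (hδ.trans (add_comm _ _)), hc]
          ring
        · rw [Nat.ascFactorial_succ, Nat.cast_mul, mul_comm]
          refine mul_dvd_mul hn ?_
          rwa [hc, add_right_comm] at hm
        · rw [hl, smul_smul]

/-- The `p`-th power of `ad e_α` vanishes modulo `p`. -/
theorem exists_ad_pow_eq_smul (hB : IsChevalleyBasis b B) {p : ℕ} (hp : 2 ≤ p) (α : H.root)
    (j : H.root ⊕ b.support) : ∃ y ∈ Submodule.span ℤ (Set.range B),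
      ((ad ℂ g (B (.inl α))) ^ p) (B j) = (p : ℤ) • y := by
  have hbas : ∀ i, B i ∈ Submodule.span ℤ (Set.range B) := fun i => Submodule.subset_span ⟨i, rfl⟩
  obtain ⟨q, rfl⟩ := Nat.exists_eq_add_of_le' hp
  have hself : (ad ℂ g (B (.inl α))) (B (.inl α)) = 0 := lie_self _
  rcases j with β | k
  · by_cases h1 : β = α
    · subst h1
      exact ⟨0, zero_mem _, by rw [pow_succ, Module.End.mul_apply, hself, map_zero, smul_zero]⟩
    by_cases h2 : (rootSystem H).root β = -(rootSystem H).root α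
    · have h3 : (ad ℂ g (B (.inl α))) (B (.inl β)) = ((rootSystem H).coroot α : g) :=
        hB.lie_neg α β h2
      have h4 : (ad ℂ g (B (.inl α))) ((rootSystem H).coroot α : g) = (-2 : ℤ) • B (.inl α) := by
        have h5 := lie_eq_smul_of_mem_rootSpace (hB.root_mem α) ((rootSystem H).coroot α)
        have h6 : (α : LieModule.Weight ℂ H g) ((rootSystem H).coroot α) = 2 :=
          (rootSystem H).root_coroot_two α
        rw [h6] at h5
        have h7 : ⁅((rootSystem H).coroot α : g), B (.inl α)⁆ = (2 : ℂ) • B (.inl α) := h5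
        rw [ad_apply, ← lie_skew, h7, neg_smul, two_smul, two_smul]
      rw [pow_add, Module.End.mul_apply, pow_two, Module.End.mul_apply, h3, h4, map_zsmul]
      -- For p = 2 the value -2 e_α is itself divisible by p; for larger p one more application
      -- kills it.
      rcases q with _ | q
      · exact ⟨-B (.inl α), neg_mem (hbas _), by simp⟩
      · exact ⟨0, zero_mem _, by
          rw [pow_succ, Module.End.mul_apply, hself, map_zero, smul_zero, smul_zero]⟩
    · have hli : LinearIndependent ℂ ![(rootSystem H).root α, (rootSystem H).root β] :=
        RootPairing.IsReduced.linearIndependent _ (Ne.symm h1)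
          fun h => h2 (by rw [h, neg_neg])
      rcases hB.ad_pow_inl_eq_zero_or hli (q + 2) with h | ⟨γ, -, -, n, hn, h⟩
      · exact ⟨0, zero_mem _, by rw [h, smul_zero]⟩
      · have hdvd : ((q + 2 : ℕ) : ℤ) ∣ n := by
          refine dvd_trans (Int.natCast_dvd_natCast.2 ?_) hn
          exact (Nat.dvd_factorial (by omega) le_rfl).trans (Nat.factorial_dvd_ascFactorial _ _)
        obtain ⟨m, rfl⟩ := hdvd
        exact ⟨m • B (.inl γ), Submodule.smul_mem _ m (hbas _), by rw [h, mul_smul]⟩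
  · refine ⟨0, zero_mem _, ?_⟩
    have h3 : (ad ℂ g (B (.inl α))) (B (.inr k)) =
        -((rootSystem H).pairingIn ℤ α k • B (.inl α)) := by
      rw [ad_apply, ← lie_skew, hB.lie_inr_inl]
    rw [pow_add, Module.End.mul_apply, pow_two, Module.End.mul_apply, h3, map_neg, map_zsmul, hself,
      smul_zero, neg_zero, map_zero, smul_zero]

end IsChevalleyBasis

end ModularReduction

/-! ### Reduction modulo p: trivial centre, restricted structure and depth for simple Lie algebras.
-/

namespace ModularReduction

namespace IntegralFrame

variable {ι g : Type*} [LieRing g] [LieAlgebra ℂ g] (F : IntegralFrame ι g)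
  (R : Type*) [CommRing R] [Algebra R ℂ] [LieAlgebra R g] [IsScalarTower R ℂ g]
  (K : Type*) [Field K] [Algebra R K]

theorem ad_one_tmul_pow (x y : F.gR R) (n : ℕ) :
    ((LieAlgebra.ad K (F.gK R K) (1 ⊗ₜ x)) ^ n) (1 ⊗ₜ y) =
      1 ⊗ₜ (((LieAlgebra.ad R (F.gR R) x) ^ n) y) := by
  induction n with
  | zero => rfl
  | succ n ih =>
    rw [pow_succ', pow_succ', Module.End.mul_apply, Module.End.mul_apply, ih, LieAlgebra.ad_apply,
      LieAlgebra.ExtendScalars.bracket_tmul, one_mul, LieAlgebra.ad_apply]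

theorem coe_ad_pow (x y : F.gR R) (n : ℕ) :
    ((((LieAlgebra.ad R (F.gR R) x) ^ n) y : F.gR R) : g) =
      ((LieAlgebra.ad ℂ g (x : g)) ^ n) (y : g) := by
  induction n with
  | zero => rfl
  | succ n ih =>
    rw [pow_succ', pow_succ', Module.End.mul_apply, Module.End.mul_apply, ← ih]
    rfl

theorem ad_pow_eq_zero_of_dvd (p : ℕ) [CharP K p] (i : ι)
    (h : ∀ j, ∃ y ∈ Submodule.span ℤ (Set.range F.basis),
      ((LieAlgebra.ad ℂ g (F.basis i)) ^ p) (F.basis j) = (p : ℤ) • y) :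
    (LieAlgebra.ad K (F.gK R K) (1 ⊗ₜ F.basisElt R i)) ^ p = 0 := by
  refine LinearMap.ext_on (F.span_one_tmul_basisElt R K) ?_
  rintro _ ⟨j, rfl⟩
  obtain ⟨y, hy, he⟩ := h j
  have hyR : y ∈ F.gR R := Submodule.span_le_restrictScalars ℤ R _ hy
  have he' : ((LieAlgebra.ad R (F.gR R) (F.basisElt R i)) ^ p) (F.basisElt R j) =
      (p : ℤ) • (⟨y, hyR⟩ : F.gR R) := by
    refine Subtype.ext ((F.coe_ad_pow R _ _ p).trans ?_)
    exact he
  dsimp only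
  rw [ad_one_tmul_pow, he', TensorProduct.tmul_smul, ← Int.cast_smul_eq_zsmul K, Int.cast_natCast,
    CharP.cast_eq_zero, zero_smul, LinearMap.zero_apply]

/-- The basis `𝓑` as a `K`-basis of `𝔤_K`. -/
def basisK [FaithfulSMul R ℂ] : Module.Basis ι K (F.gK R K) :=
  (F.basisR R).baseChange K

theorem basisK_apply [FaithfulSMul R ℂ] (i : ι) : F.basisK R K i = 1 ⊗ₜ F.basisElt R i := by
  rw [basisK, Module.Basis.baseChange_apply, basisR_apply]

theorem lie_basisK_of_eq_zsmul [FaithfulSMul R ℂ] {i j k : ι} {n : ℤ}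
    (h : ⁅F.basis i, F.basis j⁆ = n • F.basis k) :
    ⁅F.basisK R K i, F.basisK R K j⁆ = (n : K) • F.basisK R K k := by
  have h' : ⁅F.basisElt R i, F.basisElt R j⁆ = n • F.basisElt R k := Subtype.ext h
  rw [basisK_apply, basisK_apply, basisK_apply, LieAlgebra.ExtendScalars.bracket_tmul, one_mul, h',
    TensorProduct.tmul_smul, Int.cast_smul_eq_zsmul]

end IntegralFrame

/-- A Lie algebra with a basis of weight vectors `e_α` and commuting elements `h_k` has trivial
centre if all weights are nonzero and some of them form an invertible matrix. -/
theorem eq_zero_of_forall_lie_eq_zero {K L ι κ : Type*} [Field K] [LieRing L] [LieAlgebra K L]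
    [Fintype ι] [Fintype κ] [DecidableEq κ] (e : Module.Basis (ι ⊕ κ) K L) (c : ι → κ → K)
    (hhe : ∀ k α, ⁅e (.inr k), e (.inl α)⁆ = c α k • e (.inl α))
    (hhh : ∀ k l, ⁅e (.inr k), e (.inr l)⁆ = 0) (hc : ∀ α, ∃ k, c α k ≠ 0) (s : κ → ι)
    (hdet : (Matrix.of fun l k => c (s l) k).det ≠ 0) {x : L} (hx : ∀ y : L, ⁅x, y⁆ = 0) :
    x = 0 := by
  have hsum : x = (∑ α, e.repr x (.inl α) • e (.inl α)) + ∑ k, e.repr x (.inr k) • e (.inr k) := by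
    conv_lhs => rw [← e.sum_repr x, Fintype.sum_sum_type]
  -- Bracketing with h_k multiplies the coefficient of e_α by `c α k`, which is nonzero for a
  -- suitable `k`.
  have hinl : ∀ α, e.repr x (.inl α) = 0 := by
    intro α
    obtain ⟨k, hk⟩ := hc α
    have h1 : ⁅e (.inr k), x⁆ = ∑ α, (e.repr x (.inl α) * c α k) • e (.inl α) := by
      conv_lhs => rw [hsum]
      simp only [lie_add, lie_sum, lie_smul, hhe, hhh, smul_zero, Finset.sum_const_zero, add_zero,
        smul_smul]
    have h2 : ⁅e (.inr k), x⁆ = 0 := by rw [← lie_skew, hx, neg_zero]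
    rw [h2] at h1
    have h3 := (Fintype.linearIndependent_iff.1 (e.linearIndependent.comp _ Sum.inl_injective)) _
      h1.symm α
    exact (mul_eq_zero.1 h3).resolve_right hk
  -- Only toral coefficients are left, and the brackets with the chosen root vectors say that the
  -- invertible matrix kills their vector.
  have hinr : (fun k => e.repr x (.inr k)) = 0 := by
    refine Matrix.eq_zero_of_mulVec_eq_zero hdet ?_
    ext l
    have h1 : ⁅x, e (.inl (s l))⁆ =
        (∑ k, e.repr x (.inr k) * c (s l) k) • e (.inl (s l)) := by
      conv_lhs => rw [hsum]
      simp only [hinl, zero_smul, Finset.sum_const_zero, zero_add, sum_lie, smul_lie, hhe,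
        smul_smul, Finset.sum_smul]
    rw [hx] at h1
    have h2 := (smul_eq_zero.1 h1.symm).resolve_right (e.ne_zero _)
    rw [Pi.zero_apply, ← h2]
    simp [Matrix.mulVec, dotProduct, mul_comm]
  rw [hsum]
  simp only [hinl, fun k => congrFun hinr k, Pi.zero_apply, zero_smul, Finset.sum_const_zero,
    add_zero]

open LieAlgebra LieAlgebra.IsKilling

variable {g : Type*} [LieRing g] [LieAlgebra ℂ g] [FiniteDimensional ℂ g] [LieAlgebra.IsKilling ℂ g]
  {H : LieSubalgebra ℂ g} [H.IsCartanSubalgebra]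
  {b : (rootSystem H).Base} {B : Module.Basis (H.root ⊕ b.support) ℂ g}
  (R : Type*) [CommRing R] [Algebra R ℂ] [FaithfulSMul R ℂ] [LieAlgebra R g] [IsScalarTower R ℂ g]
  (K : Type*) [Field K] [Algebra R K] {p : ℕ} [CharP K p]

open Classical in
theorem IsVeryGood.det_ne_zero (hgood : IsVeryGood b p) :
    (b.cartanMatrix.map (Int.cast : ℤ → K)).det ≠ 0 := by
  have h := Int.cast_det (R := K) b.cartanMatrix
  rw [← h]
  exact fun h0 => hgood.2 ((CharP.intCast_eq_zero_iff K p _).1 h0)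

/-- If all pairings vanished modulo p, the coefficient vector of α in the simple roots would be
killed by the Cartan matrix, which is invertible modulo p. So p would divide every coefficient,
contrary to p being good. -/
theorem IsVeryGood.exists_pairingIn_ne_zero (hgood : IsVeryGood b p) (α : H.root) :
    ∃ k : b.support, ((rootSystem H).pairingIn ℤ α k : K) ≠ 0 := by
  classical
  by_contra! hall
  obtain ⟨f, -, -, hf⟩ := b.exists_root_eq_sum_int α
  have hf' : (rootSystem H).root α = ∑ i : b.support, f i • (rootSystem H).root i := by
    rw [hf, ← Finset.sum_coe_sort]
  have hzero : Matrix.vecMul (fun i : b.support => (f i : K))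
      (b.cartanMatrix.map (Int.cast : ℤ → K)) = 0 := by
    ext k
    rw [Pi.zero_apply, ← hall k]
    have h1 : (rootSystem H).pairingIn ℤ α k =
        ∑ i : b.support, f i * (rootSystem H).pairingIn ℤ i k := by
      apply Int.cast_injective (α := ℂ)
      have h2 : ∀ i j, (((rootSystem H).pairingIn ℤ i j : ℤ) : ℂ) = (rootSystem H).pairing i j :=
        fun i j => (rootSystem H).algebraMap_pairingIn ℤ i j
      rw [h2, Int.cast_sum]
      simp only [Int.cast_mul, h2]
      rw [← RootPairing.root_coroot'_eq_pairing, hf', map_sum]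
      refine Finset.sum_congr rfl fun i _ => ?_
      rw [map_zsmul, RootPairing.root_coroot'_eq_pairing, zsmul_eq_mul]
    rw [h1]
    simp [Matrix.vecMul, dotProduct, RootPairing.Base.cartanMatrix,
      RootPairing.Base.cartanMatrixIn_def]
  have hf0 := Matrix.eq_zero_of_vecMul_eq_zero (hgood.det_ne_zero K) hzero
  have hne : ∃ i : b.support, f i ≠ 0 := by
    by_contra! h
    apply (rootSystem H).ne_zero α
    rw [hf']
    exact Finset.sum_eq_zero fun i _ => by rw [h i, zero_smul]
  obtain ⟨i, hi⟩ := hne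
  exact hgood.1 α (fun i => f i) hf' i hi ((CharP.intCast_eq_zero_iff K p _).1 (congrFun hf0 i))

theorem ad_chevalleyFrame_injective (hB : IsChevalleyBasis b B) (hgood : IsVeryGood b p) :
    Function.Injective (LieAlgebra.ad K ((chevalleyFrame hB).gK R K)) := by
  classical
  rw [injective_iff_map_eq_zero]
  intro x hx
  let e := (chevalleyFrame hB).basisK R K
  have hhe : ∀ k α, ⁅e (.inr k), e (.inl α)⁆ =
      ((rootSystem H).pairingIn ℤ α k : K) • e (.inl α) := fun k α =>
    (chevalleyFrame hB).lie_basisK_of_eq_zsmul R K (hB.lie_inr_inl k α)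
  have hhh : ∀ k l, ⁅e (.inr k), e (.inr l)⁆ = 0 := by
    intro k l
    have h := (chevalleyFrame hB).lie_basisK_of_eq_zsmul R K (i := .inr k) (j := .inr l)
      (k := .inr k) (n := 0) ((hB.lie_inr_inr k l).trans (zero_smul ℤ _).symm)
    rwa [Int.cast_zero, zero_smul] at h
  exact eq_zero_of_forall_lie_eq_zero e (fun α k => ((rootSystem H).pairingIn ℤ α k : K)) hhe hhh
    (hgood.exists_pairingIn_ne_zero K) (fun l => (l : H.root)) (hgood.det_ne_zero K)
    fun y => LinearMap.congr_fun hx y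

theorem adPMap_chevalleyFrame_eq_zero (hB : IsChevalleyBasis b B) (hgood : IsVeryGood b p)
    (hp : 2 ≤ p) (α : H.root) :
    adPMap (chevalleyFrame hB) R K p (1 ⊗ₜ (chevalleyFrame hB).basisElt R (.inl α)) = 0 := by
  refine pMapOf_eq_zero (ad_chevalleyFrame_injective R K hB hgood) ?_
  rw [map_zero]
  exact (chevalleyFrame hB).ad_pow_eq_zero_of_dvd R K p _ (hB.exists_ad_pow_eq_smul hp α)

/-- The depth of the negative root vectors in the lower central series of `𝔫⁻`. -/
def chevalleyDepth (b : (rootSystem H).Base) : H.root ⊕ b.support → ℕ :=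
  Sum.elim (fun α => (-b.height α).toNat) fun _ => 0

theorem chevalleyFrame_sgn_inl (hB : IsChevalleyBasis b B) (α : H.root) :
    (chevalleyFrame hB).sgn (.inl α) = -1 ↔ b.height α < 0 := by
  classical
  change (if b.IsPos α then (1 : SignType) else -1) = -1 ↔ _
  have h0 := b.height_ne_zero α
  rw [RootPairing.Base.isPos_iff]
  split_ifs with h
  · exact ⟨fun h' => absurd h' (by decide), fun h' => by omega⟩
  · exact ⟨fun _ => by omega, fun _ => rfl⟩

theorem chevalleyFrame_lie_mem (hB : IsChevalleyBasis b B) (i j : H.root ⊕ b.support)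
    (hi : (chevalleyFrame hB).sgn i = -1) (hj : (chevalleyFrame hB).sgn j = -1) :
    ⁅(chevalleyFrame hB).basis i, (chevalleyFrame hB).basis j⁆ ∈
      Submodule.span ℤ ((chevalleyFrame hB).basis ''
        {l | (chevalleyFrame hB).sgn l = -1 ∧ l ∉ (chevalleyFrame hB).negSimple ∧
          chevalleyDepth b i < chevalleyDepth b l ∧ chevalleyDepth b j < chevalleyDepth b l}) := by
  rcases i with α | k
  swap
  · exact absurd (show (0 : SignType) = -1 from hi) (by decide)
  rcases j with β | k
  swap
  · exact absurd (show (0 : SignType) = -1 from hj) (by decide)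
  rw [chevalleyFrame_sgn_inl] at hi hj
  have hneg : (rootSystem H).root β ≠ -(rootSystem H).root α := by
    intro h
    -- Writing -α as α + (-2)α gives β the height opposite to that of α, but both heights are
    -- negative.
    have := b.height_add_zsmul (i := α) (j := α) (k := β) (z := -2) (by rw [h]; module)
    rw [smul_eq_mul] at this
    omega
  rcases hB.lie_inl_eq_zero_or hneg with h | ⟨γ, hγ, n, -, h⟩
  · exact (congrArg (· ∈ _) h).mpr (zero_mem _)
  · refine (congrArg (· ∈ _) h).mpr (Submodule.smul_mem _ n (Submodule.subset_span ⟨.inl γ, ?_, rfl⟩))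
    have hh := b.height_add hγ
    refine ⟨(chevalleyFrame_sgn_inl hB γ).2 (by omega), ?_, ?_, ?_⟩
    · rintro ⟨γ', β', hβ', h1, h2⟩
      obtain rfl := Sum.inl_injective h2
      -- The negative of a simple root has height -1, whereas γ has height at most -2 as a sum of
      -- two negative roots.
      have h3 := b.height_add_zsmul (i := β') (j := β') (k := γ) (z := -2) (by rw [h1]; module)
      rw [smul_eq_mul, b.height_one_of_mem_support hβ'] at h3
      omega
    · change (-b.height α).toNat < (-b.height γ).toNat
      omega
    · change (-b.height β).toNat < (-b.height γ).toNat
      omega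

end ModularReduction

end

/-! ### The theorem for simple Lie algebras and for gl_N. -/

open ModularReduction in
theorem corollary3 {p : ℕ} [Fact p.Prime] {K : Type*} [Field K] [IsAlgClosed K] [CharP K p]
    (S : Submonoid ℤ) (hS : S.FG) {R : Type*} [CommRing R] [IsLocalization S R]
    [Algebra R ℂ] [FaithfulSMul R ℂ] [Algebra R K] (hp : ¬ IsUnit (p : R)) :
    -- `𝔤_ℂ` simple, with a Chevalley basis `B`
    (∀ {g : Type*} [LieRing g] [LieAlgebra ℂ g] [FiniteDimensional ℂ g] [LieAlgebra.IsSimple ℂ g]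
      [LieAlgebra R g] [IsScalarTower R ℂ g]
      (H : LieSubalgebra ℂ g) [H.IsCartanSubalgebra]
      (b : (LieAlgebra.IsKilling.rootSystem H).Base)
      (B : Module.Basis (H.root ⊕ b.support) ℂ g) (hB : IsChevalleyBasis b B)
      (_ : ∀ q : ℕ, q.Prime → ¬ IsVeryGood b q → (q : ℤ) ∈ S)
      (chi : Module.Dual K ((chevalleyFrame hB).gK R K))
      (_ : (chevalleyFrame hB).IsStandardLevi R K chi)
      (lam : Module.Dual R ((chevalleyFrame hB).partR R 0)),
      Nontrivial ((chevalleyFrame hB).Lpchi R K p (adPMap (chevalleyFrame hB) R K p) chi lam) →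
        IsSimpleModule ((chevalleyFrame hB).Uchi R K p (adPMap (chevalleyFrame hB) R K p) chi)
          ((chevalleyFrame hB).Lchi R K p (adPMap (chevalleyFrame hB) R K p) chi
            ((chevalleyFrame hB).tilde R K lam)) ∧
        ∃ f : (chevalleyFrame hB).Lpchi R K p (adPMap (chevalleyFrame hB) R K p) chi lam
            →ₗ[(chevalleyFrame hB).Uchi R K p (adPMap (chevalleyFrame hB) R K p) chi]
            (chevalleyFrame hB).Lchi R K p (adPMap (chevalleyFrame hB) R K p) chi
              ((chevalleyFrame hB).tilde R K lam),
          Function.Surjective f) ∧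
    -- `𝔤_ℂ = gl_N(ℂ)`, with the basis of matrix units
    (∀ (N : ℕ) (_ : ∀ q : ℕ, q.Prime → q ∣ N → (q : ℤ) ∈ S)
      (chi : Module.Dual K ((glFrame N).gK R K))
      (_ : (glFrame N).IsStandardLevi R K chi)
      (lam : Module.Dual R ((glFrame N).partR R 0)),
      Nontrivial ((glFrame N).Lpchi R K p (glPMap R K N p) chi lam) →
        IsSimpleModule ((glFrame N).Uchi R K p (glPMap R K N p) chi)
          ((glFrame N).Lchi R K p (glPMap R K N p) chi ((glFrame N).tilde R K lam)) ∧
        ∃ f : (glFrame N).Lpchi R K p (glPMap R K N p) chi lam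
            →ₗ[(glFrame N).Uchi R K p (glPMap R K N p) chi]
            (glFrame N).Lchi R K p (glPMap R K N p) chi ((glFrame N).tilde R K lam),
          Function.Surjective f) := by
  classical
  have hp2 : 2 ≤ p := (Fact.out : p.Prime).two_le
  refine ⟨?_, ?_⟩
  · intro g _ _ _ _ _ _ H _ b B hB hS chi hchi lam hnt
    -- A prime that is not very good lies in `S` and so is a unit of R, which p is not.
    have hgood : IsVeryGood b p := by
      by_contra hbad
      apply hp
      have h := IsLocalization.map_units R (⟨p, hS p Fact.out hbad⟩ : S)
      simpa using h
    exact (chevalleyFrame hB).exists_surjective_of_pMap_eq_zero R K p _ chi hchi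
      (chevalleyDepth b)
      (fun i hi => by
        rcases i with α | k
        · exact adPMap_chevalleyFrame_eq_zero R K hB hgood hp2 α
        · exact absurd (show (0 : SignType) = -1 from hi) (by decide))
      (chevalleyFrame_lie_mem hB) lam
  · intro N _ chi hchi lam hnt
    exact (glFrame N).exists_surjective_of_pMap_eq_zero R K p _ chi hchi
      (fun ij => (ij.1 - ij.2 : ℕ))
      (fun ij hij => glPMap_basisElt_eq_zero R K N hp2 fun h => by
        rw [glFrame_sgn_eq_neg_one_iff, h] at hij
        exact lt_irrefl _ hij)
      glFrame_lie_mem lam
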